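/- Let $\{G_n,\iota_{nm}\}_{n\in\mathbb N}$ be a countable directed system of connected complex affine algebraic groups whose transition maps $\iota_{nm}:G_n\hookrightarrow G_m$ ($n\le m$) are homomorphic embeddings of algebraic groups. Let $G=\varinjlim G_n$ be the direct limit group, $\mathfrak g_n=\mathrm{Lie}(G_n)$ (right invariant vector fields), $\mathfrak g=\varinjlim\mathfrak g_n$ the direct limit Lie algebra, and $\mathfrak g^*=\varprojlim\mathfrak g_n^*$ its full dual, on which $G$ acts by the coadjoint action. For $\mu\in\mathfrak g^*$ let $\mu_n\in\mathfrak g_n^*$ be its restriction to $\mathfrak g_n$, let $G_n^{\mu}\subseteq G_n$ be the isotropy group of $\mu$ in $G_n$, $\mathfrak g_n^{\mu}=\mathrm{Lie}(G_n^{\mu})$ and $\mathfrak g^\mu=\varinjlim\mathfrak g_n^\mu$; let $G_n^{\mu_n}$ be the isotropy group of $\mu_n$ for the coadjoint action of $G_n$ on $\mathfrak g_n^*$, and $\mathfrak g_n^{\mu_n}=\mathrm{Lie}(G_n^{\mu_n})$. Fix $\lambda\in\mathfrak g^*$. Its coadjoint orbit $G\cdot\lambda=\varinjlim G_n\cdot\lambda$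 is an ind-variety, where $G_n\cdot\lambda\subseteq\mathfrak g^*$ has the variety structure of $G_n/G_n^{\lambda}$. For $\mu\in G_n\cdot\lambda$ identify $T_\mu(G_n\cdot\lambda)=\mathfrak g_n/\mathfrak g_n^\mu$ and $T_{\mu_n}(G_n\cdot\lambda_n)=\mathfrak g_n/\mathfrak g_n^{\mu_n}$ (the class of $X$ being the velocity of $\exp(tX)\cdot\mu$, respectively $\exp(tX)\cdot\mu_n$, at $t=0$), and for $\mu\in G\cdot\lambda$ put $T_\mu(G\cdot\lambda)=\varinjlim T_\mu(G_n\cdot\lambda)=\mathfrak g/\mathfrak g^\mu$. Let $\omega_n$ be the Kostant–Kirillov form on the coadjoint orbit $G_n\cdot\lambda_n\subseteq\mathfrak g_n^*$, $(\omega_n)_\nu(X+\mathfrak g_n^\nu,Y+\mathfrak g_n^\nu)=\nu([X,Y])$, and let $p_n:G_n\cdot\lambda\to G_n\cdot\lambda_n$, $\mu\mapsto\mu_n$, be the projection, with differential $(dp_n)_\mu(X+\mathfrak g_n^\mu)=X+\mathfrak g_n^{\mu_n}$. Then there is a unique family $\omega_\infty$ of bilinear forms $(\omega_\infty)_\mu$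 on the tangent spaces $T_\mu(G\cdot\lambda)$, $\mu\in G\cdot\lambda$, whose pullback to $G_n\cdot\lambda$ is $p_n^*\omega_n$ for every $n$. For all $\mu\in G\cdot\lambda$ (in particular $\mu=\lambda$) it is given by $$(\omega_\infty)_\mu(X+\mathfrak g^\mu,\,Y+\mathfrak g^\mu)=\mu([X,Y])\qquad(X,Y\in\mathfrak g),$$ and it is a weak symplectic form on $G\cdot\lambda$, that is: 1. $\omega_\infty$ is a $2$-form (each $(\omega_\infty)_\mu$ is alternating, and the pullback of $\omega_\infty$ to each $G_n\cdot\lambda$ is a regular $2$-form), and it is closed for the differential $d_{2,\infty}(\alpha_1,\alpha_2,\dots)=(d\alpha_1,d\alpha_2,\dots)$ on $\varprojlim_n\Omega^2(G_n\cdot\lambda)$: the exterior derivative of its pullback to $G_n\cdot\lambda$ vanishes for every $n$. 2. For each $\mu\in G\cdot\lambda$ the linear map $T_\mu(G\cdot\lambda)\to T_\mu(G\cdot\lambda)^*$, $v\mapsto(\omega_\infty)_\mu(v,\cdot)$, is injective, and it is regular as a map from the linear ind-variety $\varinjlim_m T_\mu(G_m\cdot\mu)$ to the linear provariety $\varprojlim_k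 T_\mu^*(G_k\cdot\mu)$: for all $m,k$ the induced map $T_\mu(G_m\cdot\mu)\to T_\mu^*(G_k\cdot\mu)$ is a morphism of finite dimensional affine varieties. -/

import Mathlib

universe u

noncomputable section

/-! ### Complex affine algebraic groups (as varieties of points with their coordinate rings) -/

/-- The structure of a complex affine algebraic group on a group `G`: a finitely generated
`ℂ`-algebra `coord` of functions on `G` (the regular functions, or coordinate ring) such that
every `ℂ`-algebra homomorphism `coord → ℂ` is the evaluation at exactly one point of `G`, and such
that multiplication `G × G → G` and inversion `G → G` are morphisms of varieties. -/
class AffineAlgGroup (G : Type u) [Group G] where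
  coord : Subalgebra ℂ (G → ℂ)
  fg : coord.FG
  eval_bijective : Function.Bijective
    (fun g : G => ((Pi.evalAlgHom ℂ (fun _ : G => ℂ) g).comp coord.val : coord →ₐ[ℂ] ℂ))
  mul_regular : ∀ f ∈ coord, ∃ (k : ℕ) (a b : Fin k → coord),
    ∀ x y : G, f (x * y) = ∑ i, (a i : G → ℂ) x * (b i : G → ℂ) y
  inv_regular : ∀ f ∈ coord, (fun x : G => f x⁻¹) ∈ coord

namespace AffineAlgGroup

section One

variable (G : Type u) [Group G] [AffineAlgGroup G]

/-- The coordinate ring `ℂ[G]`. -/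
abbrev Coord : Type u := (coord : Subalgebra ℂ (G → ℂ))

/-- The Zariski topology on `G`; the principal open sets form a basis of it. -/
@[reducible]
def zariski : TopologicalSpace G :=
  TopologicalSpace.generateFrom {V | ∃ f : Coord G, V = {x | (f : G → ℂ) x ≠ 0}}

variable {G}

theorem coord_ext {f h : Coord G} (e : ∀ x, (f : G → ℂ) x = (h : G → ℂ) x) : f = h :=
  Subtype.ext (funext e)

/-- `f` is a regular function on the set `V` (meant to be Zariski open): near every point of `V` it
is a quotient of two elements of the coordinate ring. Values of `f` outside `V` play no role. -/
def IsRegularOn (V : Set G) (f : G → ℂ) : Prop :=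
  ∀ g ∈ V, ∃ a b : Coord G, (b : G → ℂ) g ≠ 0 ∧
    ∀ x ∈ V, (b : G → ℂ) x ≠ 0 → f x = (a : G → ℂ) x / (b : G → ℂ) x

theorem mul_exists (f : Coord G) : ∃ (k : ℕ) (a b : Fin k → Coord G),
    ∀ x y : G, (f : G → ℂ) (x * y) = ∑ i, (a i : G → ℂ) x * (b i : G → ℂ) y :=
  mul_regular f.1 f.2

theorem sum_coe {k : ℕ} (a : Fin k → Coord G) (x : G) :
    ((∑ i, a i : Coord G) : G → ℂ) x = ∑ i, (a i : G → ℂ) x := by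
  rw [AddSubmonoidClass.coe_finsetSum, Finset.sum_apply]

theorem rTrans_mem (g : G) (f : Coord G) : (fun x => (f : G → ℂ) (x * g)) ∈ (coord (G := G)) := by
  obtain ⟨k, a, b, h⟩ := mul_exists f
  have : (fun x => (f : G → ℂ) (x * g)) = ((∑ i, (b i : G → ℂ) g • a i : Coord G) : G → ℂ) := by
    funext x
    rw [sum_coe, h]
    exact Finset.sum_congr rfl fun i _ => by simp [mul_comm]
  rw [this]
  exact Subtype.property _

theorem lTrans_mem (g : G) (f : Coord G) : (fun x => (f : G → ℂ) (g * x)) ∈ (coord (G := G)) := by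
  obtain ⟨k, a, b, h⟩ := mul_exists f
  have : (fun x => (f : G → ℂ) (g * x)) = ((∑ i, (a i : G → ℂ) g • b i : Coord G) : G → ℂ) := by
    funext x
    rw [sum_coe, h]
    exact Finset.sum_congr rfl fun i _ => by simp
  rw [this]
  exact Subtype.property _

/-- Right translation of functions: `(rTrans g f) x = f (x * g)`. -/
def rTrans (g : G) : Coord G →ₐ[ℂ] Coord G where
  toFun f := ⟨fun x => (f : G → ℂ) (x * g), rTrans_mem g f⟩
  map_one' := rfl
  map_mul' _ _ := rfl
  map_zero' := rfl
  map_add' _ _ := rfl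
  commutes' _ := rfl

@[simp] theorem rTrans_apply (g : G) (f : Coord G) (x : G) :
    (rTrans g f : G → ℂ) x = (f : G → ℂ) (x * g) := rfl

variable (G) in
/-- The Lie algebra of `G`: the right invariant vector fields on `G`, that is, the derivations of
the coordinate ring which commute with right translations. -/
def lieAlg : LieSubalgebra ℂ (Derivation ℂ (Coord G) (Coord G)) where
  carrier := {X | ∀ (g : G) (f : Coord G), X (rTrans g f) = rTrans g (X f)}
  add_mem' := by
    intro X Y hX hY g f
    simp [hX g f, hY g f]
  zero_mem' := by
    intro g f
    simp
  smul_mem' := by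
    intro c X hX g f
    simp [hX g f]
  lie_mem' := by
    intro X Y hX hY g f
    rw [Derivation.commutator_apply, hY g f, hX g f, hX g (Y f), hY g (X f), ← map_sub,
      ← Derivation.commutator_apply]

variable (G) in
/-- The Lie algebra of `G`, as a type. -/
def LieAlg : Type u := lieAlg G

instance : LieRing (LieAlg G) := inferInstanceAs (LieRing (lieAlg G))

instance : LieAlgebra ℂ (LieAlg G) := inferInstanceAs (LieAlgebra ℂ (lieAlg G))

instance : AddCommGroup (LieAlg G) := LieRing.toAddCommGroup

instance : AddCommMonoid (LieAlg G) := AddCommGroup.toAddCommMonoid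

instance : Module ℂ (LieAlg G) := LieAlgebra.toModule

/-- The value at the unit element of the vector field `X`, as a point derivation. -/
def tangentAt (X : LieAlg G) : Coord G →ₗ[ℂ] ℂ where
  toFun f := (X.1 f : G → ℂ) 1
  map_add' _ _ := by simp
  map_smul' _ _ := by simp

theorem tangentAt_add (X Y : LieAlg G) (f : Coord G) :
    tangentAt (X + Y) f = tangentAt X f + tangentAt Y f := rfl

theorem tangentAt_smul (c : ℂ) (X : LieAlg G) (f : Coord G) :
    tangentAt (c • X) f = c * tangentAt X f := rfl

theorem tangentAt_zero (f : Coord G) : tangentAt (0 : LieAlg G) f = 0 := rfl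

theorem tangentAt_one (X : LieAlg G) (c : ℂ) : tangentAt X (algebraMap ℂ (Coord G) c) = 0 := by
  change ((X.1 (algebraMap ℂ (Coord G) c) : Coord G) : G → ℂ) 1 = 0
  rw [Derivation.map_algebraMap]
  rfl

theorem tangentAt_lie (X Y : LieAlg G) (f : Coord G) :
    tangentAt ⁅X, Y⁆ f = tangentAt X (Y.1 f) - tangentAt Y (X.1 f) := rfl

theorem lieAlg_apply (X : LieAlg G) (f : Coord G) (g : G) :
    (X.1 f : G → ℂ) g = tangentAt X (rTrans g f) := by
  have := X.2 g f
  change _ = (X.1 (rTrans g f) : G → ℂ) 1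
  rw [this]
  simp

theorem lieAlg_ext {X Y : LieAlg G} (h : ∀ f, tangentAt X f = tangentAt Y f) : X = Y := by
  apply Subtype.ext
  ext f : 1
  apply coord_ext
  intro g
  rw [lieAlg_apply, lieAlg_apply, h]

theorem tangentAt_mul (X : LieAlg G) (f h : Coord G) : tangentAt X (f * h) =
    (f : G → ℂ) 1 * tangentAt X h + (h : G → ℂ) 1 * tangentAt X f := by
  simp [tangentAt]

/-- The tangent space at the unit element of a closed subgroup (or subset containing `1`) `H`
of `G`, as a subspace of the Lie algebra of `G`: the vectors that annihilate the ideal of all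
regular functions vanishing on `H`. For a closed subgroup `H` this is `Lie(H)`. -/
def lieOf (H : Set G) : Submodule ℂ (LieAlg G) where
  carrier := {X | ∀ f : Coord G, (∀ h ∈ H, (f : G → ℂ) h = 0) → tangentAt X f = 0}
  add_mem' := by
    intro X Y hX hY f hf
    rw [tangentAt_add, hX f hf, hY f hf, add_zero]
  zero_mem' := fun f _ => tangentAt_zero f
  smul_mem' := by
    intro c X hX f hf
    rw [tangentAt_smul, hX f hf, mul_zero]

theorem lieOf_mono {H K : Set G} (h : H ⊆ K) : lieOf H ≤ lieOf K :=
  fun _ hX f hf => hX f fun x hx => hf x (h hx)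

end One

section Hom

variable {G H K : Type u} [Group G] [Group H] [Group K]
  [AffineAlgGroup G] [AffineAlgGroup H] [AffineAlgGroup K]

/-- A homomorphism of groups is a homomorphism of algebraic groups if it is a morphism of
varieties: it pulls regular functions back to regular functions. -/
def IsRegularHom (φ : G →* H) : Prop :=
  ∀ f : Coord H, (fun x => (f : H → ℂ) (φ x)) ∈ (coord (G := G))

/-- The comorphism of a homomorphism of algebraic groups. -/
def comap (φ : G →* H) (hφ : IsRegularHom φ) : Coord H →ₐ[ℂ] Coord G where
  toFun f := ⟨fun x => (f : H → ℂ) (φ x), hφ f⟩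
  map_one' := rfl
  map_mul' _ _ := rfl
  map_zero' := rfl
  map_add' _ _ := rfl
  commutes' _ := rfl

@[simp] theorem comap_apply (φ : G →* H) (hφ : IsRegularHom φ) (f : Coord H) (x : G) :
    (comap φ hφ f : G → ℂ) x = (f : H → ℂ) (φ x) := rfl

/-- A homomorphic embedding of algebraic groups (a closed embedding): a homomorphism of algebraic
groups whose comorphism is surjective. -/
def IsEmbedding (φ : G →* H) : Prop :=
  ∃ hφ : IsRegularHom φ, Function.Surjective (comap φ hφ)

theorem lieMap_mem (φ : G →* H) (hφ : IsRegularHom φ) (X : LieAlg G) (f : Coord H) :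
    (fun h => tangentAt X (comap φ hφ (rTrans h f))) ∈ (coord (G := H)) := by
  obtain ⟨k, a, b, e⟩ := mul_exists f
  have key : (fun h => tangentAt X (comap φ hφ (rTrans h f))) =
      ((∑ i, tangentAt X (comap φ hφ (a i)) • b i : Coord H) : H → ℂ) := by
    funext h
    have : comap φ hφ (rTrans h f) = ∑ i, (b i : H → ℂ) h • comap φ hφ (a i) := by
      apply coord_ext
      intro x
      rw [sum_coe]
      simp [e, mul_comm]
    rw [this, sum_coe, map_sum]
    exact Finset.sum_congr rfl fun i _ => by simp [mul_comm]
  rw [key]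
  exact Subtype.property _

/-- The differential at the unit element of a homomorphism of algebraic groups: the point
derivation `X_e ∘ φ^*` extended to a right invariant vector field. -/
def lieMapFun (φ : G →* H) (hφ : IsRegularHom φ) (X : LieAlg G) : LieAlg H :=
  ⟨Derivation.mk'
    { toFun := fun f => ⟨fun h => tangentAt X (comap φ hφ (rTrans h f)), lieMap_mem φ hφ X f⟩
      map_add' := fun f f' => coord_ext fun h => by simp
      map_smul' := fun c f => coord_ext fun h => by simp }
    (fun f f' => coord_ext fun h => by
      simp [tangentAt_mul]),
   fun g f => coord_ext fun h => by
    have : rTrans h (rTrans g f) = rTrans (h * g) f := coord_ext fun x => by simp [mul_assoc]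
    simp [this]⟩

theorem tangentAt_lieMapFun (φ : G →* H) (hφ : IsRegularHom φ) (X : LieAlg G) (f : Coord H) :
    tangentAt (lieMapFun φ hφ X) f = tangentAt X (comap φ hφ f) := by
  change tangentAt X (comap φ hφ (rTrans 1 f)) = _
  congr 2
  exact coord_ext fun x => by simp

theorem comap_lieMapFun (φ : G →* H) (hφ : IsRegularHom φ) (X : LieAlg G) (f : Coord H) :
    comap φ hφ ((lieMapFun φ hφ X).1 f) = X.1 (comap φ hφ f) := by
  apply coord_ext
  intro g
  rw [lieAlg_apply]
  change tangentAt X (comap φ hφ (rTrans (φ g) f)) = _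
  congr 1
  exact coord_ext fun x => by simp

/-- The differential of a homomorphism of algebraic groups, a homomorphism of Lie algebras. -/
def lieMap (φ : G →* H) (hφ : IsRegularHom φ) : LieAlg G →ₗ⁅ℂ⁆ LieAlg H where
  toFun := lieMapFun φ hφ
  map_add' X Y := lieAlg_ext fun f => by
    simp only [tangentAt_add, tangentAt_lieMapFun]
  map_smul' c X := lieAlg_ext fun f => by
    simp only [tangentAt_smul, tangentAt_lieMapFun, RingHom.id_apply]
  map_lie' := by
    intro X Y
    apply lieAlg_ext
    intro f
    rw [tangentAt_lieMapFun, tangentAt_lie, tangentAt_lie, tangentAt_lieMapFun,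
      tangentAt_lieMapFun, comap_lieMapFun, comap_lieMapFun]

theorem tangentAt_lieMap (φ : G →* H) (hφ : IsRegularHom φ) (X : LieAlg G) (f : Coord H) :
    tangentAt (lieMap φ hφ X) f = tangentAt X (comap φ hφ f) :=
  tangentAt_lieMapFun φ hφ X f

/-- The chain rule. -/
theorem lieMap_lieMap (φ : G →* H) (hφ : IsRegularHom φ) (ψ : H →* K) (hψ : IsRegularHom ψ)
    (χ : G →* K) (hχ : IsRegularHom χ) (e : ∀ x, ψ (φ x) = χ x) (X : LieAlg G) :
    lieMap ψ hψ (lieMap φ hφ X) = lieMap χ hχ X :=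
  lieAlg_ext fun f => by
    rw [tangentAt_lieMap, tangentAt_lieMap, tangentAt_lieMap]
    congr 1
    exact coord_ext fun x => by simp [e]

theorem lieMap_self (φ : G →* G) (hφ : IsRegularHom φ) (e : ∀ x, φ x = x) (X : LieAlg G) :
    lieMap φ hφ X = X :=
  lieAlg_ext fun f => by
    rw [tangentAt_lieMap]
    congr 1
    exact coord_ext fun x => by simp [e]

theorem isRegularHom_conj (g : G) : IsRegularHom (MulAut.conj g).toMonoidHom :=
  fun f => lTrans_mem g ⟨_, rTrans_mem g⁻¹ f⟩

/-- `Ad g`, the differential of the conjugation `x ↦ g * x * g⁻¹`. -/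
def adMap (g : G) : LieAlg G →ₗ⁅ℂ⁆ LieAlg G :=
  lieMap (MulAut.conj g).toMonoidHom (isRegularHom_conj g)

theorem adMap_one (X : LieAlg G) : adMap 1 X = X :=
  lieMap_self _ _ (by simp) X

theorem adMap_mul (g h : G) (X : LieAlg G) : adMap (g * h) X = adMap g (adMap h X) :=
  (lieMap_lieMap _ _ _ _ _ _ (by simp) X).symm

theorem lieMap_adMap (φ : G →* H) (hφ : IsRegularHom φ) (g : G) (X : LieAlg G) :
    lieMap φ hφ (adMap g X) = adMap (φ g) (lieMap φ hφ X) := by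
  have hr : IsRegularHom (φ.comp (MulAut.conj g).toMonoidHom) := fun f =>
    isRegularHom_conj g (comap φ hφ f)
  exact (lieMap_lieMap _ _ _ _ _ hr (by simp) X).trans
    (lieMap_lieMap _ _ _ _ _ hr (by simp) X).symm

variable (G) in
/-- The adjoint representation of an algebraic group. -/
def adRep : Representation ℂ G (LieAlg G) where
  toFun g := (adMap g : LieAlg G →ₗ[ℂ] LieAlg G)
  map_one' := LinearMap.ext adMap_one
  map_mul' g h := LinearMap.ext (adMap_mul g h)

variable (G) in
/-- The coadjoint representation of an algebraic group. -/
def coadRep : Representation ℂ G (Module.Dual ℂ (LieAlg G)) := (adRep G).dual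

theorem coadRep_apply (g : G) (ν : Module.Dual ℂ (LieAlg G)) (X : LieAlg G) :
    coadRep G g ν X = ν (adMap g⁻¹ X) := rfl

/-- The isotropy group of `ν` for the coadjoint action. -/
def stab (ν : Module.Dual ℂ (LieAlg G)) : Set G := {g | coadRep G g ν = ν}

end Hom

section KostantKirillov

variable {G : Type u} [Group G] [AffineAlgGroup G]

instance lieAlg_finite : Module.Finite ℂ (LieAlg G) := by
  obtain ⟨s, hs⟩ := (fg : (coord (G := G)).FG)
  have hmem : ∀ f ∈ s, f ∈ (coord (G := G)) := fun f hf => hs ▸ Algebra.subset_adjoin hf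
  let ev : LieAlg G →ₗ[ℂ] (s → ℂ) :=
    { toFun := fun X f => tangentAt X ⟨f.1, hmem f.1 f.2⟩
      map_add' := fun _ _ => rfl
      map_smul' := fun _ _ => rfl }
  refine Module.Finite.of_injective ev ((injective_iff_map_eq_zero ev).2 fun X hX => ?_)
  apply lieAlg_ext
  intro f
  rw [tangentAt_zero]
  obtain ⟨f, hf⟩ := f
  have hf' : f ∈ Algebra.adjoin ℂ (s : Set (G → ℂ)) := by rw [hs]; exact hf
  revert hf
  induction hf' using Algebra.adjoin_induction with
  | mem x hx => intro hf; exact congrFun hX ⟨x, hx⟩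
  | algebraMap r =>
    intro hf
    have : (⟨algebraMap ℂ (G → ℂ) r, hf⟩ : Coord G) = algebraMap ℂ (Coord G) r := rfl
    rw [this, tangentAt_one]
  | add x y hx hy h1 h2 =>
    intro hf
    have hx' : x ∈ (coord (G := G)) := by rw [← hs]; exact hx
    have hy' : y ∈ (coord (G := G)) := by rw [← hs]; exact hy
    have : (⟨x + y, hf⟩ : Coord G) = ⟨x, hx'⟩ + ⟨y, hy'⟩ := rfl
    rw [this, map_add, h1 hx', h2 hy', add_zero]
  | mul x y hx hy h1 h2 =>
    intro hf
    have hx' : x ∈ (coord (G := G)) := by rw [← hs]; exact hx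
    have hy' : y ∈ (coord (G := G)) := by rw [← hs]; exact hy
    have : (⟨x * y, hf⟩ : Coord G) = ⟨x, hx'⟩ * ⟨y, hy'⟩ := rfl
    rw [this, tangentAt_mul, h1 hx', h2 hy', mul_zero, mul_zero, add_zero]

theorem dual_surjective_of_separating {V W : Type*} [AddCommGroup V] [Module ℂ V]
    [FiniteDimensional ℂ V] [AddCommGroup W] [Module ℂ W] (E : W →ₗ[ℂ] Module.Dual ℂ V)
    (h : ∀ v, (∀ w, E w v = 0) → v = 0) : Function.Surjective E := by
  have hco : (LinearMap.range E).dualCoannihilator = ⊥ := by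
    rw [eq_bot_iff]
    intro v hv
    rw [Submodule.mem_dualCoannihilator] at hv
    rw [Submodule.mem_bot]
    exact h v fun w => hv (E w) ⟨w, rfl⟩
  have htop : LinearMap.range E = ⊤ := by
    rw [← Subspace.dualCoannihilator_dualAnnihilator_eq (W := LinearMap.range E), hco]
    simp
  exact LinearMap.range_eq_top.1 htop

/-- Every linear functional on the Lie algebra is the differential at `1` of a regular function. -/
theorem exists_coord_of_dual (ν : Module.Dual ℂ (LieAlg G)) :
    ∃ f : Coord G, ∀ X, ν X = tangentAt X f := by
  let E : Coord G →ₗ[ℂ] Module.Dual ℂ (LieAlg G) :=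
    { toFun := fun f =>
        { toFun := fun X => tangentAt X f
          map_add' := fun _ _ => rfl
          map_smul' := fun _ _ => rfl }
      map_add' := fun f h => LinearMap.ext fun X => map_add (tangentAt X) f h
      map_smul' := fun c f => LinearMap.ext fun X => map_smul (tangentAt X) c f }
  obtain ⟨f, hf⟩ := dual_surjective_of_separating E (fun X hX => lieAlg_ext fun f => by
    rw [tangentAt_zero]
    exact hX f) ν
  exact ⟨f, fun X => by rw [← hf]; rfl⟩

/-- The differential of the coadjoint action at the unit element. -/
theorem exists_coord_coad (ν : Module.Dual ℂ (LieAlg G)) (Y : LieAlg G) :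
    ∃ F : Coord G, (∀ g, (F : G → ℂ) g = coadRep G g ν Y) ∧
      ∀ X : LieAlg G, tangentAt X F = ν ⁅X, Y⁆ := by
  obtain ⟨f, hf⟩ := exists_coord_of_dual ν
  obtain ⟨k, a, b, e⟩ := mul_exists f
  have hinv : ∀ u : Coord G, ∃ v : Coord G, (∀ x, (v : G → ℂ) x = (u : G → ℂ) x⁻¹) ∧
      ∀ X : LieAlg G, tangentAt X v = - tangentAt X u := by
    intro u
    refine ⟨⟨_, inv_regular u.1 u.2⟩, fun x => rfl, fun X => ?_⟩
    obtain ⟨l, p, q, e'⟩ := mul_exists u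
    have hc : (algebraMap ℂ (Coord G) ((u : G → ℂ) 1)) =
        ∑ j, p j * (⟨_, inv_regular (q j).1 (q j).2⟩ : Coord G) := by
      apply coord_ext
      intro x
      rw [sum_coe]
      have := e' x x⁻¹
      rw [mul_inv_cancel] at this
      exact this
    have h1 := congrArg (tangentAt X) hc
    rw [tangentAt_one, map_sum] at h1
    simp only [tangentAt_mul, inv_one] at h1
    have hu : u = ∑ j, (q j : G → ℂ) 1 • p j := by
      apply coord_ext
      intro x
      rw [sum_coe]
      have := e' x 1
      rw [mul_one] at this
      rw [this]
      exact Finset.sum_congr rfl fun i _ => by simp [mul_comm]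
    have hv : (⟨_, inv_regular u.1 u.2⟩ : Coord G) =
        ∑ j, (p j : G → ℂ) 1 • (⟨_, inv_regular (q j).1 (q j).2⟩ : Coord G) := by
      apply coord_ext
      intro x
      rw [sum_coe]
      have := e' 1 x⁻¹
      rw [one_mul] at this
      exact this
    have hu' := congrArg (tangentAt X) hu
    have hv' := congrArg (tangentAt X) hv
    simp only [map_sum, map_smul, smul_eq_mul] at hu' hv'
    rw [Finset.sum_add_distrib] at h1
    rw [hv', hu']
    linear_combination -h1
  choose a' ha' ha'' using fun i => hinv (a i)
  refine ⟨∑ i, a' i * Y.1 (b i), fun g => ?_, fun X => ?_⟩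
  · rw [coadRep_apply, hf, adMap, tangentAt_lieMap]
    have : comap (MulAut.conj g⁻¹).toMonoidHom (isRegularHom_conj g⁻¹) f =
        ∑ i, (a i : G → ℂ) g⁻¹ • rTrans g (b i) := by
      apply coord_ext
      intro x
      rw [sum_coe]
      have := e g⁻¹ (x * g)
      rw [← mul_assoc] at this
      simpa using this
    rw [this, map_sum, sum_coe]
    refine Finset.sum_congr rfl fun i _ => ?_
    rw [map_smul, ← lieAlg_apply, ← ha' i]
    rfl
  · have hf1 : f = ∑ i, (a i : G → ℂ) 1 • b i := by
      apply coord_ext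
      intro x
      rw [sum_coe]
      have := e 1 x
      rw [one_mul] at this
      exact this
    have hXf : X.1 f = ∑ i, tangentAt X (a i) • b i := by
      apply coord_ext
      intro y
      rw [lieAlg_apply, sum_coe]
      have : rTrans y f = ∑ i, (b i : G → ℂ) y • a i := by
        apply coord_ext
        intro x
        rw [sum_coe]
        simp [e, mul_comm]
      rw [this, map_sum]
      exact Finset.sum_congr rfl fun i _ => by simp [mul_comm]
    have hYf : Y.1 f = ∑ i, (a i : G → ℂ) 1 • Y.1 (b i) := by
      conv_lhs => rw [hf1]
      simp
    have hbr : ν ⁅X, Y⁆ = tangentAt X (Y.1 f) - tangentAt Y (X.1 f) := by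
      rw [hf, tangentAt_lie]
    rw [hbr, hYf, hXf]
    simp only [map_sum, map_smul, smul_eq_mul, tangentAt_mul, ha'', ha', inv_one]
    rw [← Finset.sum_sub_distrib]
    refine Finset.sum_congr rfl fun i _ => ?_
    have : ((Y.1 (b i) : Coord G) : G → ℂ) 1 = tangentAt Y (b i) := rfl
    rw [this]
    ring

/-- The bilinear form `(X, Y) ↦ ν [X, Y]` on the Lie algebra. -/
def bracketForm {L : Type*} [LieRing L] [LieAlgebra ℂ L] (ν : Module.Dual ℂ L) :
    L →ₗ[ℂ] L →ₗ[ℂ] ℂ :=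
  LinearMap.mk₂ ℂ (fun X Y => ν ⁅X, Y⁆) (by simp) (by simp) (by simp) (by simp)

theorem bracketForm_isAlt {L : Type*} [LieRing L] [LieAlgebra ℂ L] (ν : Module.Dual ℂ L) :
    (bracketForm ν).IsAlt := fun X => by simp [bracketForm]

theorem lieOf_stab_le_ker (ν : Module.Dual ℂ (LieAlg G)) :
    lieOf (stab ν) ≤ LinearMap.ker (bracketForm ν) := by
  intro X hX
  rw [LinearMap.mem_ker]
  ext Y
  obtain ⟨F, hF, hF'⟩ := exists_coord_coad ν Y
  have h := hX (F - algebraMap ℂ (Coord G) (ν Y)) fun g hg => by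
    have h1 := hF g
    have h2 : coadRep G g ν = ν := hg
    rw [h2] at h1
    change (F : G → ℂ) g - ν Y = 0
    rw [h1, sub_self]
  rw [map_sub, hF' X, tangentAt_one, sub_zero] at h
  exact h

/-- The Kostant-Kirillov form of the coadjoint orbit through `ν`, at the point `ν`. The tangent
space of the orbit `G · ν ≅ G / G^ν` at `ν` is `𝔤 / 𝔤^ν`, where `𝔤^ν = Lie(G^ν)`, and the form is
`(X + 𝔤^ν, Y + 𝔤^ν) ↦ ν [X, Y]`. -/
def kkForm (ν : Module.Dual ℂ (LieAlg G)) :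
    (LieAlg G ⧸ lieOf (stab ν)) →ₗ[ℂ] (LieAlg G ⧸ lieOf (stab ν)) →ₗ[ℂ] ℂ :=
  (bracketForm_isAlt ν).isRefl.liftQ₂ (bracketForm ν) (lieOf (stab ν)) (lieOf_stab_le_ker ν)

@[simp] theorem kkForm_mk (ν : Module.Dual ℂ (LieAlg G)) (X Y : LieAlg G) :
    kkForm ν (Submodule.Quotient.mk X) (Submodule.Quotient.mk Y) = ν ⁅X, Y⁆ := rfl

end KostantKirillov

section Germs

variable {G : Type u} [Group G] [AffineAlgGroup G]

/-- `f = a / b` on a Zariski neighbourhood of the unit element. -/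
def IsGermOf (f : G → ℂ) (a b : Coord G) : Prop :=
  (b : G → ℂ) 1 ≠ 0 ∧ ∀ x, (b : G → ℂ) x ≠ 0 → f x = (a : G → ℂ) x / (b : G → ℂ) x

open Classical in
/-- The differential at the unit element of a function which is regular near the unit element, as
a linear form on the Lie algebra: by the quotient rule for `f = a / b`. (It does not depend on `a`
and `b`, and it is put equal to `0` if `f` is not regular near the unit element.) -/
def diffOne (f : G → ℂ) : LieAlg G →ₗ[ℂ] ℂ where
  toFun X := if h : ∃ p : Coord G × Coord G, IsGermOf f p.1 p.2 then
    ((h.choose.2 : G → ℂ) 1 * tangentAt X h.choose.1 -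
      (h.choose.1 : G → ℂ) 1 * tangentAt X h.choose.2) / (h.choose.2 : G → ℂ) 1 ^ 2 else 0
  map_add' X Y := by
    split_ifs with h
    · rw [tangentAt_add, tangentAt_add]
      ring
    · simp
  map_smul' c X := by
    split_ifs with h
    · rw [tangentAt_smul, tangentAt_smul, RingHom.id_apply, smul_eq_mul]
      ring
    · simp

theorem diffOne_eq {f : G → ℂ} {a b : Coord G} (h : IsGermOf f a b) (X : LieAlg G) :
    diffOne f X = ((b : G → ℂ) 1 * tangentAt X a - (a : G → ℂ) 1 * tangentAt X b) /
      (b : G → ℂ) 1 ^ 2 := by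
  have hex : ∃ p : Coord G × Coord G, IsGermOf f p.1 p.2 := ⟨(a, b), h⟩
  have hd : diffOne f X = ((hex.choose.2 : G → ℂ) 1 * tangentAt X hex.choose.1 -
      (hex.choose.1 : G → ℂ) 1 * tangentAt X hex.choose.2) / (hex.choose.2 : G → ℂ) 1 ^ 2 := by
    simp only [diffOne, LinearMap.coe_mk, AddHom.coe_mk]
    rw [dif_pos hex]
  obtain ⟨hb', h'⟩ := hex.choose_spec
  rw [hd]
  generalize hex.choose.1 = a' at *
  generalize hex.choose.2 = b' at *
  have hz : b * b' * (a * b' - a' * b) = 0 := by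
    apply coord_ext
    intro x
    change (b : G → ℂ) x * (b' : G → ℂ) x *
      ((a : G → ℂ) x * (b' : G → ℂ) x - (a' : G → ℂ) x * (b : G → ℂ) x) = 0
    by_cases h1 : (b : G → ℂ) x = 0
    · simp [h1]
    by_cases h2 : (b' : G → ℂ) x = 0
    · simp [h2]
    have h3 := (h.2 x h1).symm.trans (h' x h2)
    rw [div_eq_div_iff h1 h2] at h3
    rw [h3]
    ring
  have hb := h.1
  have h3 := (h.2 1 hb).symm.trans (h' 1 hb')
  rw [div_eq_div_iff hb hb'] at h3
  have h4 := congrArg (tangentAt X) hz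
  rw [map_zero, tangentAt_mul, map_sub, tangentAt_mul, tangentAt_mul] at h4
  have h5 : ((a * b' - a' * b : Coord G) : G → ℂ) 1 = 0 := by
    change (a : G → ℂ) 1 * (b' : G → ℂ) 1 - (a' : G → ℂ) 1 * (b : G → ℂ) 1 = 0
    rw [h3, sub_self]
  have h6 : ((b * b' : Coord G) : G → ℂ) 1 = (b : G → ℂ) 1 * (b' : G → ℂ) 1 := rfl
  rw [h5, h6, zero_mul, add_zero] at h4
  have h7 := (mul_eq_zero.1 h4).resolve_left (mul_ne_zero hb hb')
  rw [div_eq_div_iff (pow_ne_zero 2 hb') (pow_ne_zero 2 hb)]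
  generalize (a : G → ℂ) 1 = α at *
  generalize (a' : G → ℂ) 1 = α' at *
  generalize (b : G → ℂ) 1 = β at *
  generalize (b' : G → ℂ) 1 = β' at *
  generalize tangentAt X a = A at *
  generalize tangentAt X a' = A' at *
  generalize tangentAt X b = B at *
  generalize tangentAt X b' = B' at *
  linear_combination (-β * β') * h7 + (β * B' + β' * B) * h3

/-- The differential of a function which is constant on `H ∋ 1` vanishes on the tangent space of
`H`. -/
theorem lieOf_le_ker_diffOne (f : G → ℂ) (H : Set G) (hc : ∀ h ∈ H, f h = f 1) :
    lieOf H ≤ LinearMap.ker (diffOne f) := by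
  intro X hX
  rw [LinearMap.mem_ker]
  by_cases hex : ∃ p : Coord G × Coord G, IsGermOf f p.1 p.2
  · obtain ⟨⟨a, b⟩, hab⟩ := hex
    rw [diffOne_eq hab]
    obtain ⟨hb, h⟩ := hab
    have h1 := h 1 hb
    have h2 := hX (b * (a - f 1 • b)) fun x hx => by
      change (b : G → ℂ) x * ((a : G → ℂ) x - f 1 * (b : G → ℂ) x) = 0
      by_cases hbx : (b : G → ℂ) x = 0
      · simp [hbx]
      · have h3 := h x hbx
        rw [hc x hx] at h3
        rw [h3]
        field_simp
        ring
    rw [tangentAt_mul, map_sub, map_smul, smul_eq_mul] at h2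
    have h3 : ((a - f 1 • b : Coord G) : G → ℂ) 1 = 0 := by
      change (a : G → ℂ) 1 - f 1 * (b : G → ℂ) 1 = 0
      rw [h1]
      field_simp
      ring
    rw [h3, zero_mul, add_zero] at h2
    have h4 := (mul_eq_zero.1 h2).resolve_left hb
    have h5 : (a : G → ℂ) 1 = f 1 * (b : G → ℂ) 1 := by
      rw [h1]
      field_simp
    rw [h5]
    have : (b : G → ℂ) 1 * tangentAt X a - f 1 * (b : G → ℂ) 1 * tangentAt X b = 0 := by
      linear_combination (b : G → ℂ) 1 * h4
    rw [this, zero_div]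
  · simp only [diffOne, LinearMap.coe_mk, AddHom.coe_mk]
    rw [dif_neg hex]

end Germs

end AffineAlgGroup

/-! ### Direct limit groups and their Lie algebras -/

open AffineAlgGroup

/-- A countable directed system of connected complex affine algebraic groups, whose transition maps
are homomorphic embeddings of algebraic groups. -/
structure AlgGroupSystem where
  G : ℕ → Type u
  [group : ∀ n, Group (G n)]
  [alg : ∀ n, AffineAlgGroup (G n)]
  connected : ∀ n, @ConnectedSpace (G n) (zariski (G n))
  ι : ∀ n m, n ≤ m → G n →* G m
  ι_self : ∀ n x, ι n n le_rfl x = x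
  ι_ι : ∀ n m k (h : n ≤ m) (h' : m ≤ k) x, ι m k h' (ι n m h x) = ι n k (h.trans h') x
  embedding : ∀ n m h, IsEmbedding (ι n m h)

namespace AlgGroupSystem

attribute [instance] AlgGroupSystem.group AlgGroupSystem.alg

variable (S : AlgGroupSystem.{u})

theorem regular {n m : ℕ} (h : n ≤ m) : IsRegularHom (S.ι n m h) := (S.embedding n m h).1

/-- The transition maps `𝔤_n → 𝔤_m`. -/
def dι (n m : ℕ) (h : n ≤ m) : LieAlg (S.G n) →ₗ⁅ℂ⁆ LieAlg (S.G m) :=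
  lieMap (S.ι n m h) (S.regular h)

instance : DirectedSystem S.G (fun n m h => S.ι n m h) where
  map_self := S.ι_self
  map_map := fun _ _ _ h h' x => S.ι_ι _ _ _ h h' x

instance : DirectedSystem (fun n => LieAlg (S.G n)) (fun n m h => S.dι n m h) where
  map_self := fun n X => lieMap_self _ _ (S.ι_self n) X
  map_map := fun _ _ _ h h' X => lieMap_lieMap _ _ _ _ _ _ (S.ι_ι _ _ _ h h') X

/-- The direct limit group `G = lim G_n`. -/
abbrev Lim : Type u := DirectLimit S.G (fun n m h => S.ι n m h)

/-- The direct limit Lie algebra `𝔤 = lim 𝔤_n`. -/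
def Lie : Type u := DirectLimit (fun n => LieAlg (S.G n)) (fun n m h => S.dι n m h)

instance : AddCommGroup S.Lie :=
  inferInstanceAs (AddCommGroup
    (DirectLimit (fun n => LieAlg (S.G n)) (fun n m h => S.dι n m h)))

instance : Module ℂ S.Lie :=
  inferInstanceAs (Module ℂ
    (DirectLimit (fun n => LieAlg (S.G n)) (fun n m h => S.dι n m h)))

/-- The canonical map `G_n → G`. -/
def toLim (n : ℕ) (g : S.G n) : S.Lim := ⟦⟨n, g⟩⟧

/-- The canonical map `𝔤_n → 𝔤`. -/
def toLie (n : ℕ) : LieAlg (S.G n) →ₗ[ℂ] S.Lie :=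
  DirectLimit.Module.of ℂ ℕ (fun n => LieAlg (S.G n)) (fun n m h => S.dι n m h) n

/-- The bracket on `𝔤` is the bracket of `𝔤_n` for elements of `𝔤_n`, see `toLie_lie`. -/
instance : Bracket S.Lie S.Lie where
  bracket := DirectLimit.map₂ (fun n m h => S.dι n m h) (fun n m h => S.dι n m h)
    (fun n m h => S.dι n m h) (fun _ X Y => ⁅X, Y⁆) (fun n m h X Y => (S.dι n m h).map_lie X Y)

theorem toLie_lie (n : ℕ) (X Y : LieAlg (S.G n)) :
    ⁅S.toLie n X, S.toLie n Y⁆ = S.toLie n ⁅X, Y⁆ :=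
  DirectLimit.map₂_def _ _ _ _ _ _ _ _

theorem toLie_dι {n m : ℕ} (h : n ≤ m) (X : LieAlg (S.G n)) :
    S.toLie m (S.dι n m h X) = S.toLie n X :=
  DirectLimit.Module.of_f

theorem toLim_ι {n m : ℕ} (h : n ≤ m) (g : S.G n) : S.toLim m (S.ι n m h g) = S.toLim n g :=
  (DirectLimit.eq_of_le (⟨n, g⟩ : Σ i, S.G i) m h).symm

theorem exists_toLim (g : S.Lim) : ∃ n x, g = S.toLim n x := DirectLimit.exists_eq_mk _ g

theorem exists_toLim₂ (g h : S.Lim) : ∃ n x y, g = S.toLim n x ∧ h = S.toLim n y :=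
  DirectLimit.exists_eq_mk₂ _ g h

theorem exists_toLie (X : S.Lie) : ∃ n x, X = S.toLie n x := DirectLimit.exists_eq_mk _ X

theorem exists_toLie₂ (X Y : S.Lie) : ∃ n x y, X = S.toLie n x ∧ Y = S.toLie n y :=
  DirectLimit.exists_eq_mk₂ _ X Y

theorem exists_toLie₃ (X Y Z : S.Lie) :
    ∃ n x y z, X = S.toLie n x ∧ Y = S.toLie n y ∧ Z = S.toLie n z :=
  DirectLimit.exists_eq_mk₃ _ X Y Z

theorem toLim_one (n : ℕ) : S.toLim n 1 = 1 := (DirectLimit.one_def n).symm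

theorem toLim_mul (n : ℕ) (x y : S.G n) : S.toLim n (x * y) = S.toLim n x * S.toLim n y :=
  (DirectLimit.mul_def n x y).symm

theorem toLim_inv (n : ℕ) (x : S.G n) : S.toLim n x⁻¹ = (S.toLim n x)⁻¹ :=
  (DirectLimit.inv_def n x).symm

instance : LieRing S.Lie where
  add_lie X Y Z := by
    obtain ⟨n, x, y, z, rfl, rfl, rfl⟩ := S.exists_toLie₃ X Y Z
    rw [← map_add, toLie_lie, toLie_lie, toLie_lie, ← map_add, add_lie]
  lie_add X Y Z := by
    obtain ⟨n, x, y, z, rfl, rfl, rfl⟩ := S.exists_toLie₃ X Y Z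
    rw [← map_add, toLie_lie, toLie_lie, toLie_lie, ← map_add, lie_add]
  lie_self X := by
    obtain ⟨n, x, rfl⟩ := S.exists_toLie X
    rw [toLie_lie, lie_self, map_zero]
  leibniz_lie X Y Z := by
    obtain ⟨n, x, y, z, rfl, rfl, rfl⟩ := S.exists_toLie₃ X Y Z
    rw [toLie_lie, toLie_lie, toLie_lie, toLie_lie, toLie_lie, toLie_lie, ← map_add, leibniz_lie]

instance : LieAlgebra ℂ S.Lie where
  lie_smul c X Y := by
    obtain ⟨n, x, y, rfl, rfl⟩ := S.exists_toLie₂ X Y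
    rw [← map_smul, toLie_lie, toLie_lie, ← map_smul, lie_smul]

/-- The function underlying the adjoint representation of `G` on `𝔤`: for `g` in `G_n` and `X` in
`𝔤_n` it is `Ad g X` computed in `𝔤_n`, see `adFun_toLim`. -/
def adFun : S.Lim → S.Lie → S.Lie :=
  DirectLimit.map₂ (fun n m h => S.ι n m h) (fun n m h => S.dι n m h) (fun n m h => S.dι n m h)
    (fun _ g X => adMap g X) (fun n m h g X => lieMap_adMap (S.ι n m h) (S.regular h) g X)

theorem adFun_toLim (n : ℕ) (g : S.G n) (X : LieAlg (S.G n)) :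
    S.adFun (S.toLim n g) (S.toLie n X) = S.toLie n (adMap g X) :=
  DirectLimit.map₂_def _ _ _ _ _ _ _ _

theorem exists_toLim_toLie (g : S.Lim) (X : S.Lie) :
    ∃ n x Y, g = S.toLim n x ∧ X = S.toLie n Y := by
  obtain ⟨n, x, rfl⟩ := S.exists_toLim g
  obtain ⟨m, Y, rfl⟩ := S.exists_toLie X
  exact ⟨max n m, S.ι n _ (le_max_left n m) x, S.dι m _ (le_max_right n m) Y,
    (S.toLim_ι _ x).symm, (S.toLie_dι _ Y).symm⟩

/-- The adjoint representation of `G` on `𝔤`. -/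
def adRep : Representation ℂ S.Lim S.Lie where
  toFun g :=
    { toFun := S.adFun g
      map_add' := fun X Y => by
        obtain ⟨n, x, rfl⟩ := S.exists_toLim g
        obtain ⟨m, X, Y, rfl, rfl⟩ := S.exists_toLie₂ X Y
        rw [← S.toLim_ι (le_max_left n m), ← S.toLie_dι (le_max_right n m) X,
          ← S.toLie_dι (le_max_right n m) Y, ← map_add, adFun_toLim, adFun_toLim, adFun_toLim,
          map_add, map_add]
      map_smul' := fun c X => by
        obtain ⟨n, x, X, rfl, rfl⟩ := S.exists_toLim_toLie g X
        rw [← map_smul, adFun_toLim, adFun_toLim, map_smul, map_smul]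
        rfl }
  map_one' := LinearMap.ext fun X => by
    obtain ⟨n, X, rfl⟩ := S.exists_toLie X
    change S.adFun 1 (S.toLie n X) = S.toLie n X
    rw [← S.toLim_one n, adFun_toLim, adMap_one]
  map_mul' g h := LinearMap.ext fun X => by
    change S.adFun (g * h) X = S.adFun g (S.adFun h X)
    obtain ⟨n, x, y, rfl, rfl⟩ := S.exists_toLim₂ g h
    obtain ⟨m, X, rfl⟩ := S.exists_toLie X
    rw [← S.toLim_ι (le_max_left n m), ← S.toLim_ι (le_max_left n m),
      ← S.toLie_dι (le_max_right n m) X, ← toLim_mul, adFun_toLim, adFun_toLim, adFun_toLim,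
      adMap_mul]

/-- The dual space `𝔤^* = lim 𝔤_n^*`. -/
abbrev Dual : Type u := Module.Dual ℂ S.Lie

/-- The coadjoint representation of `G` on `𝔤^*`. -/
def coadRep : Representation ℂ S.Lim S.Dual := S.adRep.dual

/-- The projection `𝔤^* → 𝔤_n^*`, `μ ↦ μ_n`. -/
def proj (n : ℕ) : S.Dual →ₗ[ℂ] Module.Dual ℂ (LieAlg (S.G n)) := (S.toLie n).dualMap

theorem proj_coadRep (n : ℕ) (g : S.G n) (μ : S.Dual) :
    S.proj n (S.coadRep (S.toLim n g) μ) = AffineAlgGroup.coadRep (S.G n) g (S.proj n μ) := by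
  ext X
  change μ (S.adRep (S.toLim n g)⁻¹ (S.toLie n X)) = μ (S.toLie n (adMap g⁻¹ X))
  rw [← toLim_inv]
  exact congrArg μ (S.adFun_toLim n g⁻¹ X)

/-! ### Coadjoint orbits and their tangent spaces -/

/-- The coadjoint orbit `G · lam` in `𝔤^*`. -/
def orbit (lam : S.Dual) : Set S.Dual := Set.range fun g : S.Lim => S.coadRep g lam

/-- The orbit `G_n · lam` in `𝔤^*`; the orbit `G · lam` is the increasing union of these. -/
def orbitN (n : ℕ) (lam : S.Dual) : Set S.Dual :=
  Set.range fun g : S.G n => S.coadRep (S.toLim n g) lam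

theorem orbitN_subset (n : ℕ) (lam : S.Dual) : S.orbitN n lam ⊆ S.orbit lam := by
  rintro _ ⟨g, rfl⟩
  exact ⟨_, rfl⟩

theorem coadRep_mem_orbitN {n : ℕ} {lam μ : S.Dual} (h : μ ∈ S.orbitN n lam) (g : S.G n) :
    S.coadRep (S.toLim n g) μ ∈ S.orbitN n lam := by
  obtain ⟨x, rfl⟩ := h
  refine ⟨g * x, ?_⟩
  change S.coadRep (S.toLim n (g * x)) lam = _
  rw [toLim_mul, map_mul]
  rfl

theorem self_mem_orbitN (n : ℕ) (lam : S.Dual) : lam ∈ S.orbitN n lam := by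
  refine ⟨1, ?_⟩
  change S.coadRep (S.toLim n 1) lam = lam
  rw [toLim_one, map_one]
  rfl

/-- The isotropy group `G_n^μ` of `μ ∈ 𝔤^*` in `G_n`. -/
def stabN (n : ℕ) (μ : S.Dual) : Set (S.G n) := {g | S.coadRep (S.toLim n g) μ = μ}

/-- `𝔤_n^μ = Lie(G_n^μ)`. -/
def lieStabN (n : ℕ) (μ : S.Dual) : Submodule ℂ (LieAlg (S.G n)) := lieOf (S.stabN n μ)

/-- `𝔤^μ = Lie(G^μ)`, the direct limit (here: the union in `𝔤`) of the `𝔤_n^μ`. -/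
def lieStab (μ : S.Dual) : Submodule ℂ S.Lie := ⨆ n, (S.lieStabN n μ).map (S.toLie n)

/-- The tangent space `𝔤_n / 𝔤_n^μ` at `μ` of the homogeneous space `G_n · μ ≅ G_n / G_n^μ`: the
class of `X` is the tangent vector at `t = 0` of the curve `exp(tX) · μ`. -/
abbrev TN (n : ℕ) (μ : S.Dual) : Type u := LieAlg (S.G n) ⧸ S.lieStabN n μ

/-- The tangent space `T_μ(G · μ) = 𝔤 / 𝔤^μ = lim 𝔤_n / 𝔤_n^μ`. -/
abbrev T (μ : S.Dual) : Type u := S.Lie ⧸ S.lieStab μ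

/-- The inclusion `T_μ(G_n · μ) → T_μ(G · μ)`. -/
def inclT (n : ℕ) (μ : S.Dual) : S.TN n μ →ₗ[ℂ] S.T μ :=
  Submodule.mapQ _ _ (S.toLie n) (Submodule.map_le_iff_le_comap.1
    (le_iSup (fun n => (S.lieStabN n μ).map (S.toLie n)) n))

theorem stabN_subset (n : ℕ) (μ : S.Dual) : S.stabN n μ ⊆ stab (S.proj n μ) := by
  intro g hg
  have hg' : S.coadRep (S.toLim n g) μ = μ := hg
  change AffineAlgGroup.coadRep (S.G n) g (S.proj n μ) = S.proj n μ
  rw [← proj_coadRep, hg']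

/-- The differential at `μ` of the projection `p_n : G_n · μ → G_n · μ_n`, the map
`𝔤_n / 𝔤_n^μ → 𝔤_n / 𝔤_n^{μ_n}` induced by the identity of `𝔤_n`. -/
def dp (n : ℕ) (μ : S.Dual) :
    S.TN n μ →ₗ[ℂ] (LieAlg (S.G n) ⧸ lieOf (stab (S.proj n μ))) :=
  Submodule.mapQ _ _ LinearMap.id (lieOf_mono (S.stabN_subset n μ))

/-! ### The variety `G_n · lam ≅ G_n / G_n^lam` and the calculus of vector fields and forms on it -/

section Variety

variable (n : ℕ) (lam : S.Dual)

/-- The orbit map `G_n → G_n · lam`, `g ↦ g · x`, of a point `x` of `G_n · lam`. -/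
def orbitMap (x : S.orbitN n lam) (g : S.G n) : S.orbitN n lam :=
  ⟨S.coadRep (S.toLim n g) x, S.coadRep_mem_orbitN x.2 g⟩

/-- The quotient map `G_n → G_n · lam`, `g ↦ g · lam`. -/
def quotMap : S.G n → S.orbitN n lam := S.orbitMap n lam ⟨lam, S.self_mem_orbitN n lam⟩

/-- A subset of `G_n · lam ≅ G_n / G_n^lam` is open if its inverse image in `G_n` is. -/
def IsOpenSet (U : Set (S.orbitN n lam)) : Prop :=
  @IsOpen _ (zariski (S.G n)) (S.quotMap n lam ⁻¹' U)

/-- The structure sheaf of the quotient variety `G_n · lam ≅ G_n / G_n^lam`: a function on an open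
set `U` is regular if its pullback to `G_n` is. (Values of `f` outside `U` play no role.) -/
def IsRegularFun (U : Set (S.orbitN n lam)) (f : S.orbitN n lam → ℂ) : Prop :=
  IsRegularOn (S.quotMap n lam ⁻¹' U) (f ∘ S.quotMap n lam)

/-- The differential at `x` of a function `f` on `G_n · lam` which is regular near `x`. The value on
the class of `X ∈ 𝔤_n` is the derivative at `g = 1` of `g ↦ f (g · x)` along `X`. -/
def diff (f : S.orbitN n lam → ℂ) (x : S.orbitN n lam) : S.TN n x →ₗ[ℂ] ℂ :=
  Submodule.liftQ _ (diffOne (f ∘ S.orbitMap n lam x))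
    (lieOf_le_ker_diffOne _ _ fun g hg => by
      have hg' : S.coadRep (S.toLim n g) (x : S.Dual) = x := hg
      refine congrArg f (Subtype.ext ?_)
      change S.coadRep (S.toLim n g) (x : S.Dual) = S.coadRep (S.toLim n 1) (x : S.Dual)
      rw [hg', toLim_one, map_one]
      rfl)

/-- Families of tangent vectors on `G_n · lam`. -/
abbrev TangentField : Type u := ∀ x : S.orbitN n lam, S.TN n x

/-- The derivative of a function along a family of tangent vectors. -/
def deriv (ξ : S.TangentField n lam) (f : S.orbitN n lam → ℂ) : S.orbitN n lam → ℂ :=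
  fun x => S.diff n lam f x (ξ x)

/-- `ξ` is a (regular) vector field on the open set `U`: it acts on the structure sheaf of `U`. -/
def IsVectorField (U : Set (S.orbitN n lam)) (ξ : S.TangentField n lam) : Prop :=
  ∀ V ⊆ U, S.IsOpenSet n lam V → ∀ f, S.IsRegularFun n lam V f →
    S.IsRegularFun n lam V (S.deriv n lam ξ f)

/-- On the open set `U`, the vector field `τ` is the Lie bracket `[ξ, η]`, that is, the commutator
of `ξ` and `η` as derivations of the structure sheaf. -/
def IsLieBracket (U : Set (S.orbitN n lam)) (ξ η τ : S.TangentField n lam) : Prop :=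
  ∀ V ⊆ U, S.IsOpenSet n lam V → ∀ f, S.IsRegularFun n lam V f → ∀ x ∈ V,
    S.deriv n lam τ f x =
      S.deriv n lam ξ (S.deriv n lam η f) x - S.deriv n lam η (S.deriv n lam ξ f) x

/-- Families of bilinear forms on the tangent spaces of `G_n · lam`. -/
abbrev BilinField : Type u := ∀ x : S.orbitN n lam, S.TN n x →ₗ[ℂ] S.TN n x →ₗ[ℂ] ℂ

/-- `α` is a (regular) `2`-form on `G_n · lam`: a family of alternating forms on the tangent spaces
which takes regular vector fields to regular functions. -/
def IsTwoForm (α : S.BilinField n lam) : Prop :=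
  (∀ x, (α x).IsAlt) ∧
  ∀ U, S.IsOpenSet n lam U → ∀ ξ η, S.IsVectorField n lam U ξ → S.IsVectorField n lam U η →
    S.IsRegularFun n lam U (fun x => α x (ξ x) (η x))

/-- The exterior derivative of `α` vanishes: for all vector fields `ξ`, `η`, `ζ` on an open set,
`dα(ξ, η, ζ) = ξ α(η, ζ) - η α(ξ, ζ) + ζ α(ξ, η) - α([ξ, η], ζ) + α([ξ, ζ], η) - α([η, ζ], ξ)`
is equal to `0`. -/
def IsClosedForm (α : S.BilinField n lam) : Prop :=
  ∀ U, S.IsOpenSet n lam U → ∀ ξ η ζ ξη ξζ ηζ : S.TangentField n lam,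
    S.IsVectorField n lam U ξ → S.IsVectorField n lam U η → S.IsVectorField n lam U ζ →
    S.IsVectorField n lam U ξη → S.IsVectorField n lam U ξζ → S.IsVectorField n lam U ηζ →
    S.IsLieBracket n lam U ξ η ξη → S.IsLieBracket n lam U ξ ζ ξζ →
    S.IsLieBracket n lam U η ζ ηζ →
    ∀ x ∈ U,
      S.deriv n lam ξ (fun y => α y (η y) (ζ y)) x
      - S.deriv n lam η (fun y => α y (ξ y) (ζ y)) x
      + S.deriv n lam ζ (fun y => α y (ξ y) (η y)) x
      - α x (ξη x) (ζ x) + α x (ξζ x) (η x) - α x (ηζ x) (ξ x) = 0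

/-- The pullback along `p_n : G_n · lam → G_n · lam_n` of the Kostant-Kirillov form `ω_n` of the
coadjoint orbit `G_n · lam_n ⊆ 𝔤_n^*`. -/
def pullbackKK : S.BilinField n lam :=
  fun μ => (kkForm (S.proj n μ)).compl₁₂ (S.dp n μ) (S.dp n μ)

end Variety

/-! ### Forms on the ind-variety `G · lam` -/

/-- Families of bilinear forms on the tangent spaces of `G · lam`. -/
abbrev BilinFieldLim (lam : S.Dual) : Type u :=
  ∀ μ : S.orbit lam, S.T μ →ₗ[ℂ] S.T μ →ₗ[ℂ] ℂ

/-- The restriction (pullback) of a family of bilinear forms to `G_n · lam`. -/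
def restrictN {lam : S.Dual} (ω : S.BilinFieldLim lam) (n : ℕ) : S.BilinField n lam :=
  fun μ => (ω ⟨μ, S.orbitN_subset n lam μ.2⟩).compl₁₂ (S.inclT n μ) (S.inclT n μ)

end AlgGroupSystem

/-- The regular functions on a finite dimensional vector space: the polynomial functions. -/
def polyFun (V : Type u) [AddCommGroup V] [Module ℂ V] : Subalgebra ℂ (V → ℂ) :=
  Algebra.adjoin ℂ {f | ∃ φ : Module.Dual ℂ V, f = fun v => φ v}

/-- Morphisms of affine varieties between finite dimensional vector spaces. -/
def IsPolyMap {V W : Type u} [AddCommGroup V] [Module ℂ V] [AddCommGroup W] [Module ℂ W]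
    (F : V → W) : Prop :=
  ∀ f ∈ polyFun W, f ∘ F ∈ polyFun V

namespace AlgGroupSystem

variable (S : AlgGroupSystem.{u})

/-- A map from the linear ind-variety `T_μ(G · μ) = lim T_μ(G_m · μ)` to the linear provariety
`T_μ^*(G · μ) = lim T_μ^*(G_k · μ)` is regular if all its components
`T_μ(G_m · μ) → T_μ^*(G_k · μ)` are morphisms of finite dimensional varieties. -/
def IsRegularIndPro (μ : S.Dual) (F : S.T μ → Module.Dual ℂ (S.T μ)) : Prop :=
  ∀ m k : ℕ, IsPolyMap fun v : S.TN m μ => (S.inclT k μ).dualMap (F (S.inclT m μ v))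

/-- `ω` is a weak symplectic form on the ind-variety `G · lam`: it is a `2`-form (an element of
the inverse limit of the spaces of `2`-forms on the `G_n · lam`), it is closed for
the differential `(α_n)_n ↦ (d α_n)_n`, and for each `μ` the map `v ↦ ω_μ(v, ·)` from
`T_μ(G · lam)` to `T_μ^*(G · lam)` is injective and regular. -/
structure IsWeakSymplectic {lam : S.Dual} (ω : S.BilinFieldLim lam) : Prop where
  alt : ∀ μ, (ω μ).IsAlt
  twoForm : ∀ n, S.IsTwoForm n lam (S.restrictN ω n)
  closed : ∀ n, S.IsClosedForm n lam (S.restrictN ω n)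
  injective : ∀ μ, Function.Injective (ω μ)
  regular : ∀ μ : S.orbit lam, S.IsRegularIndPro μ (ω μ)

end AlgGroupSystem

end

noncomputable section

open AffineAlgGroup

/-! ### One-parameter groups -/

section Exponential

open Finset

/-! The form has to be `μ ⁅X, Y⁆` on `𝔤 / 𝔤^μ`. Uniqueness is immediate: a point of the orbit and
two tangent vectors at it all come from a common finite level. Two facts have to be proved.

Weak nondegeneracy says that `𝔤^μ` is exactly the radical of `(X, Y) ↦ μ ⁅X, Y⁆` on `𝔤`
(`lieStab_eq_ker`). That `𝔤^μ` lies in the radical makes the form well defined; it follows by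
differentiating the coadjoint action. For the converse, if `μ ⁅X, ·⁆ = 0` on all of `𝔤`, then `exp
(tX)` fixes `μ`, so `X` is tangent to the isotropy group. The point `exp (tX)` is obtained
algebraically: an invariant vector field acts locally finitely on the coordinate ring, so `∑ tᵏ (Xᵏ
f)(1) / k!` converges; by the Leibniz rule it is multiplicative in `f`, hence it is the evaluation
at a point (`exists_exp`). On a single `G_n · lam` the pulled back form may well be degenerate; the
hypothesis on the whole of `𝔤` is what makes the argument work.

Closedness is the Jacobi identity, but for arbitrary local vector fields, which are known only
through their action on functions. The test functions are the linear functions `linFun`: the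
derivative of `linFun lam Y` along `ξ` is the pairing of `ξ` with `Y` under the form. The form on
two fields is a sum of products of such pairings (`coadRep_lie_eq_sum`), hence regular, and the
product rule gives its derivative (`diffOne_coadRep_lie`). In the formula for `dω` the second
derivatives of linear functions cancel against the Lie bracket terms, and what is left is twice a
Jacobi sum. -/

theorem Derivation.iterate_mul {A : Type*} [CommRing A] [Algebra ℂ A] (D : Derivation ℂ A A)
    (n : ℕ) (a b : A) :
    D^[n] (a * b) = ∑ ij ∈ antidiagonal n, n.choose ij.1 • (D^[ij.1] a * D^[ij.2] b) := by
  induction n with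
  | zero => simp
  | succ n ih =>
    rw [sum_antidiagonal_choose_succ_nsmul (M := A) (fun i j => D^[i] a * D^[j] b) n,
      Function.iterate_succ_apply', ih, map_sum, ← sum_add_distrib]
    refine sum_congr rfl fun ij hij => ?_
    rw [map_nsmul, Derivation.leibniz, nsmul_add, n.choose_symm_of_eq_add
      (mem_antidiagonal.1 hij).symm, Function.iterate_succ_apply', Function.iterate_succ_apply']
    simp only [smul_eq_mul]
    rw [mul_comm (D^[ij.2] b)]

theorem exists_hasSum_exp_clm {𝔸 : Type*} [NormedRing 𝔸] [NormedAlgebra ℂ 𝔸] [CompleteSpace 𝔸]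
    (x : 𝔸) (ψ : 𝔸 →L[ℂ] ℂ) :
    ∃ u : ℂ → ℂ, (∀ t, HasSum (fun k : ℕ => (k.factorial : ℂ)⁻¹ * (t ^ k * ψ (x ^ k))) (u t)) ∧
      HasDerivAt u (ψ x) 0 := by
  refine ⟨fun t => ψ (NormedSpace.exp (t • x)), fun t => ?_, ?_⟩
  · refine ((NormedSpace.exp_series_hasSum_exp' (𝕂 := ℂ) (t • x)).mapL ψ).congr_fun fun k => ?_
    rw [map_smul, smul_pow, map_smul, smul_eq_mul, smul_eq_mul]
  · have h := ψ.hasFDerivAt.comp_hasDerivAt (0 : ℂ) (hasDerivAt_exp_smul_const x (0 : ℂ))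
    rwa [zero_smul, NormedSpace.exp_zero, one_mul] at h

/-- An abstract finite dimensional `V` has no norm, so `A` is transported to coordinate space, whose
endomorphisms form a Banach algebra. -/
theorem LinearMap.exists_hasSum_exp {V : Type*} [AddCommGroup V] [Module ℂ V]
    [FiniteDimensional ℂ V] (A : Module.End ℂ V) (φ : Module.Dual ℂ V) (v : V) :
    ∃ u : ℂ → ℂ, (∀ t, HasSum (fun k : ℕ => (k.factorial : ℂ)⁻¹ * (t ^ k * φ ((A ^ k) v))) (u t)) ∧
      HasDerivAt u (φ (A v)) 0 := by
  let e := (Module.finBasis ℂ V).equivFun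
  let A' : (Fin (Module.finrank ℂ V) → ℂ) →L[ℂ] (Fin (Module.finrank ℂ V) → ℂ) :=
    LinearMap.toContinuousLinearMap (e.conj A)
  let ψ : ((Fin (Module.finrank ℂ V) → ℂ) →L[ℂ] (Fin (Module.finrank ℂ V) → ℂ)) →L[ℂ] ℂ :=
    (LinearMap.toContinuousLinearMap (φ ∘ₗ e.symm.toLinearMap)).comp
      (ContinuousLinearMap.apply ℂ _ (e v))
  have hψ : ∀ B, ψ B = φ (e.symm (B (e v))) := fun _ => rfl
  have hA : ∀ w, A' (e w) = e (A w) := fun w => by simp [A', LinearEquiv.conj_apply]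
  have hpow : ∀ k : ℕ, (A' ^ k) (e v) = e ((A ^ k) v) := by
    intro k
    induction k with
    | zero => simp
    | succ k ih =>
      rw [pow_succ', pow_succ', mul_apply_eq_comp, ih, hA, Module.End.mul_apply]
  obtain ⟨u, hu, hu'⟩ := exists_hasSum_exp_clm A' ψ
  refine ⟨u, fun t => (hu t).congr_fun fun k => ?_, ?_⟩
  · rw [hψ, hpow, e.symm_apply_apply]
  · rwa [hψ, hA, e.symm_apply_apply] at hu'

end Exponential

/-! ### Local finiteness of invariant vector fields, and the exponential map. -/

namespace AffineAlgGroup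

variable {G : Type u} [Group G] [AffineAlgGroup G]

/-- Left translation of functions: `(lTrans g f) x = f (g * x)`. -/
def lTrans (g : G) (f : Coord G) : Coord G := ⟨fun x => (f : G → ℂ) (g * x), lTrans_mem g f⟩

@[simp] theorem lTrans_apply (g : G) (f : Coord G) (x : G) :
    (lTrans g f : G → ℂ) x = (f : G → ℂ) (g * x) := rfl

theorem smul_coe (c : ℂ) (f : Coord G) (x : G) :
    ((c • f : Coord G) : G → ℂ) x = c * (f : G → ℂ) x := rfl

theorem lieAlg_apply_eq_sum (X : LieAlg G) {f : Coord G} {k : ℕ} {a b : Fin k → Coord G}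
    (e : ∀ x y : G, (f : G → ℂ) (x * y) = ∑ i, (a i : G → ℂ) x * (b i : G → ℂ) y) :
    X.1 f = ∑ i, tangentAt X (a i) • b i := by
  apply coord_ext
  intro y
  have : rTrans y f = ∑ i, (b i : G → ℂ) y • a i := by
    apply coord_ext
    intro x
    rw [sum_coe]
    simp [e, mul_comm]
  rw [lieAlg_apply, sum_coe, this, map_sum]
  exact Finset.sum_congr rfl fun i _ => by simp [mul_comm]

/-- The span of the left translates of a regular function. -/
def lSpan (f : Coord G) : Submodule ℂ (Coord G) := Submodule.span ℂ (Set.range fun g => lTrans g f)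

theorem lTrans_eq_sum {f : Coord G} {k : ℕ} {a b : Fin k → Coord G}
    (e : ∀ x y : G, (f : G → ℂ) (x * y) = ∑ i, (a i : G → ℂ) x * (b i : G → ℂ) y) (g : G) :
    lTrans g f = ∑ i, (a i : G → ℂ) g • b i := by
  apply coord_ext
  intro x
  rw [sum_coe]
  simp [e]

theorem self_mem_lSpan (f : Coord G) : f ∈ lSpan f :=
  Submodule.subset_span ⟨1, coord_ext fun x => by simp⟩

theorem lSpan_finite (f : Coord G) : FiniteDimensional ℂ (lSpan f) := by
  obtain ⟨k, a, b, e⟩ := mul_exists f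
  have hle : lSpan f ≤ Submodule.span ℂ (Set.range b) := by
    refine Submodule.span_le.2 ?_
    rintro _ ⟨g, rfl⟩
    change lTrans g f ∈ _
    rw [lTrans_eq_sum e]
    exact Submodule.sum_mem _ fun i _ => Submodule.smul_mem _ _ (Submodule.subset_span ⟨i, rfl⟩)
  have : FiniteDimensional ℂ (Submodule.span ℂ (Set.range b)) :=
    FiniteDimensional.span_of_finite ℂ (Set.finite_range b)
  exact Submodule.finiteDimensional_of_le hle

/-- `X f` is the derivative at `g = 1` of `g ↦ lTrans g f` along `X`. To stay algebraic, this is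
tested against a functional `φ` killing all left translates: `g ↦ φ (lTrans g f)` is then the zero
regular function, and applying `tangentAt X` to it gives `φ (X f) = 0`. -/
theorem lieAlg_apply_mem_lSpan (X : LieAlg G) (f : Coord G) : X.1 f ∈ lSpan f := by
  by_contra hX
  obtain ⟨φ, hφ, hle⟩ := Submodule.exists_le_ker_of_notMem hX
  obtain ⟨k, a, b, e⟩ := mul_exists f
  have h0 : ∑ i, φ (b i) • a i = 0 := by
    apply coord_ext
    intro g
    have h : φ (lTrans g f) = 0 := hle (Submodule.subset_span ⟨g, rfl⟩)
    rw [lTrans_eq_sum e, map_sum] at h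
    rw [sum_coe]
    refine Eq.trans (Finset.sum_congr rfl fun i _ => ?_) h
    rw [map_smul, smul_coe, smul_eq_mul, mul_comm]
  apply hφ
  have h1 := congrArg (tangentAt X) h0
  rw [map_zero, map_sum] at h1
  rw [lieAlg_apply_eq_sum X e, map_sum]
  refine Eq.trans (Finset.sum_congr rfl fun i _ => ?_) h1
  rw [map_smul, map_smul, smul_eq_mul, smul_eq_mul, mul_comm]

theorem lieAlg_map_lSpan (X : LieAlg G) (f : Coord G) {h : Coord G} (hh : h ∈ lSpan f) :
    X.1 h ∈ lSpan f := by
  refine (Submodule.span_le.2 ?_ : lSpan h ≤ lSpan f) (lieAlg_apply_mem_lSpan X h)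
  rintro _ ⟨g, rfl⟩
  change lTrans g h ∈ lSpan f
  induction hh using Submodule.span_induction with
  | mem x hx =>
    obtain ⟨y, rfl⟩ := hx
    exact Submodule.subset_span ⟨y * g, coord_ext fun x => by simp [mul_assoc]⟩
  | zero => exact zero_mem _
  | add x y _ _ hx hy => exact add_mem hx hy
  | smul c x _ hx => exact Submodule.smul_mem _ c hx

/-- The power series of `t ↦ f (exp (t X))` has infinite radius of convergence. -/
theorem exists_hasSum_exp (X : LieAlg G) (f : Coord G) : ∃ u : ℂ → ℂ,
    (∀ t, HasSum (fun k : ℕ => (k.factorial : ℂ)⁻¹ * (t ^ k * ((X.1^[k] f : Coord G) : G → ℂ) 1))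
      (u t)) ∧ HasDerivAt u (tangentAt X f) 0 := by
  have := lSpan_finite f
  -- By local finiteness the series is a matrix coefficient of the exponential of an endomorphism of
  -- a finite dimensional space.
  let A : Module.End ℂ (lSpan f) :=
    (X.1 : Coord G →ₗ[ℂ] Coord G).restrict fun _ h => lieAlg_map_lSpan X f h
  let φ : Module.Dual ℂ (lSpan f) :=
    { toFun := fun h => ((h : Coord G) : G → ℂ) 1
      map_add' := fun _ _ => rfl
      map_smul' := fun _ _ => rfl }
  have hpow : ∀ k : ℕ, ((A ^ k) ⟨f, self_mem_lSpan f⟩ : Coord G) = X.1^[k] f := by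
    intro k
    induction k with
    | zero => rfl
    | succ k ih =>
      rw [pow_succ', Module.End.mul_apply, Function.iterate_succ_apply', ← ih]
      rfl
  obtain ⟨u, hu, hu'⟩ := LinearMap.exists_hasSum_exp (V := lSpan f) A φ ⟨f, self_mem_lSpan f⟩
  refine ⟨u, fun t => ?_, hu'⟩
  convert hu t using 5 with k
  exact congrArg (fun h : Coord G => (h : G → ℂ) 1) (hpow k).symm

/-- The point `exp (t X)` of the one-parameter group of `X`. -/
theorem exists_exp (X : LieAlg G) (t : ℂ) : ∃ g : G, ∀ f : Coord G,
    HasSum (fun k : ℕ => (k.factorial : ℂ)⁻¹ * (t ^ k * ((X.1^[k] f : Coord G) : G → ℂ) 1))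
      ((f : G → ℂ) g) := by
  choose u hu _ using fun f => exists_hasSum_exp X f
  have hadd : ∀ (k : ℕ) (f h : Coord G), X.1^[k] (f + h) = X.1^[k] f + X.1^[k] h := fun k =>
    iterate_map_add X.1 k
  have hconst : ∀ (k : ℕ) (c : ℂ), k ≠ 0 → X.1^[k] (algebraMap ℂ (Coord G) c) = 0 := by
    rintro (_ | k) c hk
    · exact absurd rfl hk
    · rw [Function.iterate_succ_apply, Derivation.map_algebraMap, iterate_map_zero]
  have halg : ∀ c : ℂ, u (algebraMap ℂ (Coord G) c) t = c := by
    intro c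
    refine (hu _ t).unique ?_
    convert hasSum_single (f := fun k : ℕ => (k.factorial : ℂ)⁻¹ *
      (t ^ k * ((X.1^[k] (algebraMap ℂ (Coord G) c) : Coord G) : G → ℂ) 1)) 0 fun k hk => ?_ using 1
    · change c = (Nat.factorial 0 : ℂ)⁻¹ * (t ^ 0 * c)
      simp
    · rw [hconst k c hk]
      change (k.factorial : ℂ)⁻¹ * (t ^ k * 0) = 0
      simp
  -- Formally `E f = f (exp (tX))`. Multiplicativity is the Cauchy product of two absolutely
  -- convergent series combined with the iterated Leibniz rule.
  let E : Coord G →ₐ[ℂ] ℂ :=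
    { toFun := fun f => u f t
      map_one' := halg 1
      map_mul' := fun f h => by
        refine (hu _ t).unique ?_
        have hn := fun f => summable_norm_iff.2 (hu f t).summable
        have hs := summable_norm_sum_mul_antidiagonal_of_summable_norm (hn f) (hn h)
        have key := tsum_mul_tsum_eq_tsum_sum_antidiagonal_of_summable_norm (hn f) (hn h)
        rw [(hu f t).tsum_eq, (hu h t).tsum_eq] at key
        rw [key]
        refine hs.of_norm.hasSum.congr_fun fun k => ?_
        rw [Derivation.iterate_mul]
        have hval : ((∑ ij ∈ Finset.HasAntidiagonal.antidiagonal k, k.choose ij.1 •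
            (X.1^[ij.1] f * X.1^[ij.2] h) : Coord G) : G → ℂ) 1 =
            ∑ ij ∈ Finset.HasAntidiagonal.antidiagonal k, (k.choose ij.1 : ℂ) *
              (((X.1^[ij.1] f : Coord G) : G → ℂ) 1 * ((X.1^[ij.2] h : Coord G) : G → ℂ) 1) := by
          rw [AddSubmonoidClass.coe_finsetSum, Finset.sum_apply]
          refine Finset.sum_congr rfl fun ij _ => ?_
          simp
        rw [hval, Finset.mul_sum, Finset.mul_sum]
        refine Finset.sum_congr rfl fun ij hij => ?_
        obtain ⟨i, j⟩ := ij
        obtain rfl := Finset.HasAntidiagonal.mem_antidiagonal.1 hij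
        have hc := Nat.add_choose_mul_factorial_mul_factorial i j
        rw [← Nat.choose_symm_add] at hc
        have hc' : (((i + j).choose i : ℕ) : ℂ) * i.factorial * j.factorial =
            (i + j).factorial := by exact_mod_cast hc
        have h1 : (i.factorial : ℂ) ≠ 0 := by exact_mod_cast i.factorial_ne_zero
        have h2 : (j.factorial : ℂ) ≠ 0 := by exact_mod_cast j.factorial_ne_zero
        have h3 : ((i + j).factorial : ℂ) ≠ 0 := by exact_mod_cast (i + j).factorial_ne_zero
        dsimp only
        have h4 : ((i + j).factorial : ℂ)⁻¹ * ((i + j).choose i : ℕ) =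
            (i.factorial : ℂ)⁻¹ * (j.factorial : ℂ)⁻¹ := by
          field_simp
          rw [← hc']
        rw [pow_add]
        linear_combination (t ^ i * t ^ j * ((X.1^[i] f : Coord G) : G → ℂ) 1 *
          ((X.1^[j] h : Coord G) : G → ℂ) 1) * h4
      map_zero' := by simpa using halg 0
      map_add' := fun f h => by
        refine (hu _ t).unique ?_
        convert (hu f t).add (hu h t) using 2 with k
        rw [hadd]
        have : ((X.1^[k] f + X.1^[k] h : Coord G) : G → ℂ) 1 =
          ((X.1^[k] f : Coord G) : G → ℂ) 1 + ((X.1^[k] h : Coord G) : G → ℂ) 1 := rfl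
        rw [this]
        ring
      commutes' := halg }
  -- A character of the coordinate ring is a point of `G`; this point is `exp (tX)`.
  obtain ⟨g, hg⟩ := (eval_bijective (G := G)).2 E
  refine ⟨g, fun f => ?_⟩
  have : (f : G → ℂ) g = u f t := DFunLike.congr_fun hg f
  rw [this]
  exact hu f t

/-- A vector field belongs to the Lie algebra of `H` if its one-parameter group is in `H`. -/
theorem mem_lieOf_of_exp {H : Set G} {X : LieAlg G}
    (h : ∀ (t : ℂ) (g : G), (∀ f : Coord G,
      HasSum (fun k : ℕ => (k.factorial : ℂ)⁻¹ * (t ^ k * ((X.1^[k] f : Coord G) : G → ℂ) 1))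
        ((f : G → ℂ) g)) → g ∈ H) : X ∈ lieOf H := by
  intro f hf
  obtain ⟨u, hu, hu'⟩ := exists_hasSum_exp X f
  -- `u t` is the value of `f` at `exp (tX) ∈ H`, hence zero for every `t`; its derivative at `0` is
  -- `tangentAt X f`.
  have hu0 : u = fun _ => 0 := by
    funext t
    obtain ⟨g, hg⟩ := exists_exp X t
    rw [(hu t).unique (hg f), hf g (h t g hg)]
  rw [hu0] at hu'
  exact hu'.unique (hasDerivAt_const _ _)

/-- The regular function `g ↦ (g · ν) Y`. -/
def coadFun (ν : Module.Dual ℂ (LieAlg G)) (Y : LieAlg G) : Coord G :=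
  (exists_coord_coad ν Y).choose

@[simp] theorem coadFun_apply (ν : Module.Dual ℂ (LieAlg G)) (Y : LieAlg G) (g : G) :
    (coadFun ν Y : G → ℂ) g = coadRep G g ν Y := (exists_coord_coad ν Y).choose_spec.1 g

theorem tangentAt_coadFun (ν : Module.Dual ℂ (LieAlg G)) (X Y : LieAlg G) :
    tangentAt X (coadFun ν Y) = ν ⁅X, Y⁆ := (exists_coord_coad ν Y).choose_spec.2 X

theorem rTrans_coadFun (ν : Module.Dual ℂ (LieAlg G)) (Y : LieAlg G) (g : G) :
    rTrans g (coadFun ν Y) = coadFun (coadRep G g ν) Y :=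
  coord_ext fun x => by simp [map_mul]

/-- By right invariance the value at `g` is a derivative at `1` of the coefficient of `g · ν`.
Iterating, powers of `X` on coefficients become powers of `ad X` on `Y`. -/
theorem lieAlg_coadFun (ν : Module.Dual ℂ (LieAlg G)) (X Y : LieAlg G) :
    X.1 (coadFun ν Y) = coadFun ν ⁅X, Y⁆ :=
  coord_ext fun g => by
    rw [lieAlg_apply, rTrans_coadFun, tangentAt_coadFun, coadFun_apply]

theorem lieAlg_iterate_coadFun (ν : Module.Dual ℂ (LieAlg G)) (X Y : LieAlg G) (k : ℕ) :
    X.1^[k] (coadFun ν Y) = coadFun ν ((fun Z => ⁅X, Z⁆)^[k] Y) := by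
  induction k with
  | zero => rfl
  | succ k ih =>
    rw [Function.iterate_succ_apply', Function.iterate_succ_apply', ih, lieAlg_coadFun]

theorem comap_iterate {H : Type u} [Group H] [AffineAlgGroup H] (φ : G →* H)
    (hφ : IsRegularHom φ) (X : LieAlg G) (f : Coord H) (k : ℕ) :
    X.1^[k] (comap φ hφ f) = comap φ hφ ((lieMap φ hφ X).1^[k] f) := by
  induction k with
  | zero => rfl
  | succ k ih =>
    rw [Function.iterate_succ_apply', Function.iterate_succ_apply', ih]
    exact (comap_lieMapFun φ hφ X _).symm

end AffineAlgGroup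

/-! ### The radical of the bracket form is tangent to the isotropy groups. -/

namespace AlgGroupSystem

variable (S : AlgGroupSystem.{u})

/-- It suffices that `exp (tX)` fixes `μ`. This must be tested on `𝔤_m` for all `m ≥ n`, which is
why `Y` ranges over `𝔤` and not only over `𝔤_n`. On `Y ∈ 𝔤_m` the exponential series of `(exp (tX) ·
μ) Y` has coefficients given by `μ` on `(ad X)ᵏ Y`, and only the constant term survives. -/
theorem mem_lieStabN_of_bracket {n : ℕ} {μ : S.Dual} {X : LieAlg (S.G n)}
    (h : ∀ Y, μ ⁅S.toLie n X, Y⁆ = 0) : X ∈ S.lieStabN n μ := by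
  refine mem_lieOf_of_exp fun t g hg => ?_
  change S.coadRep (S.toLim n g) μ = μ
  have key : ∀ m, n ≤ m → ∀ Y : LieAlg (S.G m),
      S.coadRep (S.toLim n g) μ (S.toLie m Y) = μ (S.toLie m Y) := by
    intro m hm Y
    have hX : ∀ Z, S.proj m μ ⁅S.dι n m hm X, Z⁆ = 0 := by
      intro Z
      have h1 := h (S.toLie m Z)
      rwa [← S.toLie_dι hm, S.toLie_lie] at h1
    have h1 := hg (comap (S.ι n m hm) (S.regular hm) (coadFun (S.proj m μ) Y))
    have h2 := h1.unique (hasSum_single 0 fun k hk => ?_)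
    · simp only [comap_apply, coadFun_apply, ← S.proj_coadRep, S.toLim_ι] at h2
      refine h2.trans ?_
      simp only [Nat.factorial_zero, Nat.cast_one, inv_one, one_mul, pow_zero,
        Function.iterate_zero, id, comap_apply, map_one, coadFun_apply]
      rfl
    -- For `k ≥ 1` the outermost bracket of `(ad X)ᵏ Y` is with `X`, so `μ` kills it.
    · obtain ⟨k, rfl⟩ := Nat.exists_eq_succ_of_ne_zero hk
      rw [comap_iterate, lieAlg_iterate_coadFun, comap_apply, map_one, coadFun_apply, map_one,
        Function.iterate_succ_apply']
      have := hX ((fun Z => ⁅S.dι n m hm X, Z⁆)^[k] Y)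
      change _ * (_ * S.proj m μ _) = 0
      erw [this]
      simp
  refine LinearMap.ext fun Y => ?_
  obtain ⟨m, Y, rfl⟩ := S.exists_toLie Y
  rw [← S.toLie_dι (le_max_right n m)]
  exact key _ (le_max_left n m) _

end AlgGroupSystem

/-! ### Regular functions and germs -/

namespace AffineAlgGroup

variable {G : Type u} [Group G] [AffineAlgGroup G]

/-- The algebra of functions which are regular on `V`. -/
def regularOn (V : Set G) : Subalgebra ℂ (G → ℂ) where
  carrier := {f | IsRegularOn V f}
  mul_mem' := by
    intro f h hf hh g hg
    obtain ⟨a, b, hb, e⟩ := hf g hg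
    obtain ⟨a', b', hb', e'⟩ := hh g hg
    refine ⟨a * a', b * b', mul_ne_zero hb hb', fun x hx hx' => ?_⟩
    have h1 : (b : G → ℂ) x ≠ 0 := left_ne_zero_of_mul hx'
    have h2 : (b' : G → ℂ) x ≠ 0 := right_ne_zero_of_mul hx'
    change f x * h x = (a : G → ℂ) x * (a' : G → ℂ) x / ((b : G → ℂ) x * (b' : G → ℂ) x)
    rw [e x hx h1, e' x hx h2, div_mul_div_comm]
  add_mem' := by
    intro f h hf hh g hg
    obtain ⟨a, b, hb, e⟩ := hf g hg
    obtain ⟨a', b', hb', e'⟩ := hh g hg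
    refine ⟨a * b' + b * a', b * b', mul_ne_zero hb hb', fun x hx hx' => ?_⟩
    have h1 : (b : G → ℂ) x ≠ 0 := left_ne_zero_of_mul hx'
    have h2 : (b' : G → ℂ) x ≠ 0 := right_ne_zero_of_mul hx'
    change f x + h x = ((a : G → ℂ) x * (b' : G → ℂ) x + (b : G → ℂ) x * (a' : G → ℂ) x) /
      ((b : G → ℂ) x * (b' : G → ℂ) x)
    rw [e x hx h1, e' x hx h2, div_add_div _ _ h1 h2]
  algebraMap_mem' := fun c _ _ => ⟨algebraMap ℂ _ c, 1, one_ne_zero, fun _ _ _ => (div_one _).symm⟩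

theorem mem_regularOn {V : Set G} {f : G → ℂ} : f ∈ regularOn V ↔ IsRegularOn V f := Iff.rfl

theorem coord_le_regularOn (V : Set G) : coord (G := G) ≤ regularOn V :=
  fun f hf _ _ => ⟨⟨f, hf⟩, 1, one_ne_zero, fun _ _ _ => (div_one _).symm⟩

theorem isGermOf_coe (f : Coord G) : IsGermOf (f : G → ℂ) f 1 :=
  ⟨one_ne_zero, fun _ _ => (div_one _).symm⟩

theorem IsGermOf.mul {f h : G → ℂ} {a b a' b' : Coord G} (hf : IsGermOf f a b)
    (hh : IsGermOf h a' b') : IsGermOf (f * h) (a * a') (b * b') := by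
  refine ⟨mul_ne_zero hf.1 hh.1, fun x hx => ?_⟩
  change f x * h x = (a : G → ℂ) x * (a' : G → ℂ) x / ((b : G → ℂ) x * (b' : G → ℂ) x)
  rw [hf.2 x (left_ne_zero_of_mul hx), hh.2 x (right_ne_zero_of_mul hx), div_mul_div_comm]

theorem IsGermOf.add {f h : G → ℂ} {a b a' b' : Coord G} (hf : IsGermOf f a b)
    (hh : IsGermOf h a' b') : IsGermOf (f + h) (a * b' + b * a') (b * b') := by
  refine ⟨mul_ne_zero hf.1 hh.1, fun x hx => ?_⟩
  have h1 : (b : G → ℂ) x ≠ 0 := left_ne_zero_of_mul hx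
  have h2 : (b' : G → ℂ) x ≠ 0 := right_ne_zero_of_mul hx
  change f x + h x = ((a : G → ℂ) x * (b' : G → ℂ) x + (b : G → ℂ) x * (a' : G → ℂ) x) /
    ((b : G → ℂ) x * (b' : G → ℂ) x)
  rw [hf.2 x h1, hh.2 x h2, div_add_div _ _ h1 h2]

variable (G) in
/-- The algebra of functions which are regular near the unit element. -/
def germAlg : Subalgebra ℂ (G → ℂ) where
  carrier := {f | ∃ a b : Coord G, IsGermOf f a b}
  mul_mem' := by
    rintro f h ⟨a, b, hf⟩ ⟨a', b', hh⟩
    exact ⟨_, _, hf.mul hh⟩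
  add_mem' := by
    rintro f h ⟨a, b, hf⟩ ⟨a', b', hh⟩
    exact ⟨_, _, hf.add hh⟩
  algebraMap_mem' := fun c => ⟨_, _, isGermOf_coe (algebraMap ℂ _ c)⟩

theorem coord_le_germAlg : coord (G := G) ≤ germAlg G := fun f hf => ⟨_, _, isGermOf_coe ⟨f, hf⟩⟩

theorem diffOne_coe (f : Coord G) (X : LieAlg G) : diffOne (f : G → ℂ) X = tangentAt X f := by
  rw [diffOne_eq (isGermOf_coe f)]
  have h1 : ((1 : Coord G) : G → ℂ) 1 = 1 := rfl
  have h2 : tangentAt X (1 : Coord G) = 0 := by simpa using tangentAt_one X 1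
  rw [h1, h2]
  simp

/-- Membership in `germAlg G` rules out the default value `0` of `diffOne`, so that the quotient
rule computes all three differentials. -/
theorem diffOne_mul {f h : G → ℂ} (hf : f ∈ germAlg G) (hh : h ∈ germAlg G) (X : LieAlg G) :
    diffOne (f * h) X = f 1 * diffOne h X + h 1 * diffOne f X := by
  obtain ⟨a, b, hf⟩ := hf
  obtain ⟨a', b', hh⟩ := hh
  rw [diffOne_eq (hf.mul hh), diffOne_eq hf, diffOne_eq hh, hf.2 1 hf.1, hh.2 1 hh.1,
    tangentAt_mul, tangentAt_mul]
  have h1 := hf.1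
  have h2 := hh.1
  change ((b : G → ℂ) 1 * (b' : G → ℂ) 1 * _ - (a : G → ℂ) 1 * (a' : G → ℂ) 1 * _) /
    ((b : G → ℂ) 1 * (b' : G → ℂ) 1) ^ 2 = _
  field_simp
  ring

theorem diffOne_add {f h : G → ℂ} (hf : f ∈ germAlg G) (hh : h ∈ germAlg G) (X : LieAlg G) :
    diffOne (f + h) X = diffOne f X + diffOne h X := by
  obtain ⟨a, b, hf⟩ := hf
  obtain ⟨a', b', hh⟩ := hh
  rw [diffOne_eq (hf.add hh), diffOne_eq hf, diffOne_eq hh, map_add,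
    tangentAt_mul, tangentAt_mul, tangentAt_mul]
  have h1 := hf.1
  have h2 := hh.1
  change ((b : G → ℂ) 1 * (b' : G → ℂ) 1 * _ -
    ((a : G → ℂ) 1 * (b' : G → ℂ) 1 + (b : G → ℂ) 1 * (a' : G → ℂ) 1) * _) /
    ((b : G → ℂ) 1 * (b' : G → ℂ) 1) ^ 2 = _
  field_simp
  ring

theorem diffOne_const (c : ℂ) (X : LieAlg G) : diffOne (fun _ : G => c) X = 0 :=
  (diffOne_coe (algebraMap ℂ _ c) X).trans (tangentAt_one X c)

theorem diffOne_smul {f : G → ℂ} (hf : f ∈ germAlg G) (c : ℂ) (X : LieAlg G) :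
    diffOne (c • f) X = c * diffOne f X := by
  have h := diffOne_mul ((germAlg G).algebraMap_mem c) hf X
  have hc : diffOne (algebraMap ℂ (G → ℂ) c) X = 0 := diffOne_const c X
  rw [hc, mul_zero, add_zero] at h
  rwa [Algebra.smul_def]

theorem diffOne_sum {ι : Type*} (s : Finset ι) {f : ι → G → ℂ} (hf : ∀ i, f i ∈ germAlg G)
    (X : LieAlg G) : diffOne (∑ i ∈ s, f i) X = ∑ i ∈ s, diffOne (f i) X := by
  classical
  induction s using Finset.induction_on with
  | empty => exact diffOne_const 0 X
  | insert i s hi ih =>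
    rw [Finset.sum_insert hi, Finset.sum_insert hi, diffOne_add (hf i)
      (sum_mem fun j _ => hf j), ih]

theorem exists_basicOpen {V : Set G} (hV : @IsOpen _ (zariski G) V) {g : G} (hg : g ∈ V) :
    ∃ c : Coord G, (c : G → ℂ) g ≠ 0 ∧ ∀ x, (c : G → ℂ) x ≠ 0 → x ∈ V := by
  induction hV with
  | basic s hs =>
    obtain ⟨f, rfl⟩ := hs
    exact ⟨f, hg, fun _ h => h⟩
  | univ => exact ⟨1, one_ne_zero, fun _ _ => trivial⟩
  | inter s t _ _ h1 h2 =>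
    obtain ⟨c, hc, hc'⟩ := h1 hg.1
    obtain ⟨d, hd, hd'⟩ := h2 hg.2
    exact ⟨c * d, mul_ne_zero hc hd, fun x hx =>
      ⟨hc' x (left_ne_zero_of_mul hx), hd' x (right_ne_zero_of_mul hx)⟩⟩
  | sUnion S _ ih =>
    obtain ⟨s, hs, hgs⟩ := hg
    obtain ⟨c, hc, hc'⟩ := ih s hs hgs
    exact ⟨c, hc, fun x hx => ⟨s, hs, hc' x hx⟩⟩

/-- The right translate of a function which is regular near `g` is regular near `1`. -/
theorem IsRegularOn.mem_germAlg {V : Set G} (hV : @IsOpen _ (zariski G) V) {f : G → ℂ}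
    (hf : IsRegularOn V f) {g : G} (hg : g ∈ V) : (fun x => f (x * g)) ∈ germAlg G := by
  obtain ⟨c, hc, hc'⟩ := exists_basicOpen hV hg
  obtain ⟨a, b, hb, e⟩ := hf g hg
  -- The identity `e` holds only on `V`, whereas a germ must equal its quotient wherever the
  -- denominator is nonzero. The factor `c` confines the latter set to the translate of `V`.
  refine ⟨rTrans g (a * c), rTrans g (b * c), ?_, fun x hx => ?_⟩
  · rw [rTrans_apply, one_mul]
    exact mul_ne_zero hb hc
  · dsimp only
    rw [rTrans_apply] at hx
    have h1 : (b : G → ℂ) (x * g) ≠ 0 := left_ne_zero_of_mul hx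
    have h2 : (c : G → ℂ) (x * g) ≠ 0 := right_ne_zero_of_mul hx
    rw [e _ (hc' _ h2) h1]
    exact (mul_div_mul_right _ _ h2).symm

/-! ### The Kostant-Kirillov form along vector fields -/

/-- A substitute for dual bases when `β` is degenerate. Let `s : V^* → V` be a generalized inverse,
`β ∘ s ∘ β = β`; expand `β X` in the dual basis of `e` and put `b i = s (e.coord i)`. -/
theorem exists_sum_mul_eq {V : Type*} [AddCommGroup V] [Module ℂ V] [FiniteDimensional ℂ V]
    (β : V →ₗ[ℂ] V →ₗ[ℂ] ℂ) : ∃ (k : ℕ) (e b : Fin k → V),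
      ∀ X Y, β X Y = ∑ i, β X (e i) * β (b i) Y := by
  obtain ⟨r, hr⟩ := LinearMap.exists_rightInverse_of_surjective β.rangeRestrict
    β.range_rangeRestrict
  obtain ⟨s, hs⟩ := LinearMap.exists_extend r
  have hβ : ∀ X, β (s (β X)) = β X := by
    intro X
    have h1 : s (β X) = r (β.rangeRestrict X) := LinearMap.congr_fun hs (β.rangeRestrict X)
    have h2 := LinearMap.congr_fun hr (β.rangeRestrict X)
    rw [h1]
    exact congrArg Subtype.val h2
  let e := Module.finBasis ℂ V
  refine ⟨_, e, fun i => s (e.coord i), fun X Y => ?_⟩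
  have h : β X = ∑ i, β X (e i) • e.coord i := e.ext fun j => by
    simp
  conv_lhs => rw [← hβ X, h]
  simp only [map_sum, map_smul, LinearMap.sum_apply, LinearMap.smul_apply, smul_eq_mul]

theorem coadRep_lie (g : G) (ν : Module.Dual ℂ (LieAlg G)) (X Y : LieAlg G) :
    coadRep G g ν ⁅X, Y⁆ = ν ⁅adMap g⁻¹ X, adMap g⁻¹ Y⁆ := by
  rw [coadRep_apply, LieHom.map_lie]

theorem adMap_inv_adMap (g : G) (X : LieAlg G) : adMap g⁻¹ (adMap g X) = X := by
  rw [← adMap_mul, inv_mul_cancel, adMap_one]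

/-- The matrix coefficients of the adjoint representation. -/
def adCoord (Z : LieAlg G) (k : Fin (Module.finrank ℂ (LieAlg G))) : Coord G :=
  ⟨fun g => (coadFun ((Module.finBasis ℂ (LieAlg G)).coord k) Z : G → ℂ) g⁻¹,
    inv_regular _ (Subtype.property _)⟩

theorem adMap_eq_sum (g : G) (Z : LieAlg G) :
    adMap g Z = ∑ k, (adCoord Z k : G → ℂ) g • Module.finBasis ℂ (LieAlg G) k := by
  rw [← (Module.finBasis ℂ (LieAlg G)).sum_repr (adMap g Z)]
  refine Finset.sum_congr rfl fun k _ => ?_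
  change _ = (coadFun ((Module.finBasis ℂ (LieAlg G)).coord k) Z : G → ℂ) g⁻¹ • _
  rw [coadFun_apply, coadRep_apply, inv_inv, Module.Basis.coord_apply]

theorem adMap_inv_eq_sum (g : G) (Z : LieAlg G) :
    adMap g⁻¹ Z = ∑ k, (coadFun ((Module.finBasis ℂ (LieAlg G)).coord k) Z : G → ℂ) g •
      Module.finBasis ℂ (LieAlg G) k := by
  rw [← (Module.finBasis ℂ (LieAlg G)).sum_repr (adMap g⁻¹ Z)]
  refine Finset.sum_congr rfl fun k _ => ?_
  rw [coadFun_apply, coadRep_apply, Module.Basis.coord_apply]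

/-! ### Pairings of tangent fields with fixed and with translated vectors. -/

section Pairing

variable (ν : Module.Dual ℂ (LieAlg G)) (y z : G → LieAlg G)

/-- The pairing of the vector field `g · ν ↦ y g` with the translates of the tangent vector `Z`. -/
def twist (Z : LieAlg G) (g : G) : ℂ := coadRep G g ν ⁅y g, adMap g Z⁆

theorem twist_one (Z : LieAlg G) : twist ν y Z 1 = ν ⁅y 1, Z⁆ := by
  rw [twist, map_one, adMap_one]
  rfl

theorem twist_eq (Z : LieAlg G) (g : G) : twist ν y Z g = ν ⁅adMap g⁻¹ (y g), Z⁆ := by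
  rw [twist, coadRep_lie, adMap_inv_adMap]

theorem twist_sum {ι : Type*} (s : Finset ι) (c : ι → ℂ) (Z : ι → LieAlg G) :
    twist ν y (∑ i ∈ s, c i • Z i) = ∑ i ∈ s, c i • twist ν y (Z i) := by
  funext g
  rw [Finset.sum_apply, twist_eq, lie_sum, map_sum]
  exact Finset.sum_congr rfl fun i _ => by simp [twist_eq]

/-- The fields `y` and `z` matter only modulo isotropy and need not have regular components; only
their pairings with fixed vectors can be controlled. Moving everything back to `ν` by `Ad g⁻¹` and
factoring the form there expresses it through such pairings. The sign comes from turning `⁅b i, ·⁆`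
around. -/
theorem coadRep_lie_eq_sum {k : ℕ} {e b : Fin k → LieAlg G}
    (h : ∀ X Y : LieAlg G, ν ⁅X, Y⁆ = ∑ i, ν ⁅X, e i⁆ * ν ⁅b i, Y⁆) :
    (fun g => coadRep G g ν ⁅y g, z g⁆) =
      ∑ i, twist ν y (e i) * ((-1 : ℂ) • twist ν z (b i)) := by
  funext g
  rw [Finset.sum_apply, coadRep_lie, h]
  refine Finset.sum_congr rfl fun i _ => ?_
  simp only [Pi.mul_apply, Pi.smul_apply, twist_eq, smul_eq_mul]
  rw [← lie_skew (b i), map_neg]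
  ring

variable {ν y z} {A : Subalgebra ℂ (G → ℂ)} (hA : coord (G := G) ≤ A)
include hA

/-- `Ad g Z` has regular coordinates in a fixed basis. Two choices of `A` are used: `regularOn V`
for the regularity of the form and `germAlg G` for its derivative. -/
theorem twist_mem (hy : ∀ W, (fun g => coadRep G g ν ⁅y g, W⁆) ∈ A) (Z : LieAlg G) :
    twist ν y Z ∈ A := by
  have h : twist ν y Z = ∑ k, (adCoord Z k : G → ℂ) *
      fun g => coadRep G g ν ⁅y g, Module.finBasis ℂ (LieAlg G) k⁆ := by
    funext g
    rw [twist, adMap_eq_sum, lie_sum, map_sum, Finset.sum_apply]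
    exact Finset.sum_congr rfl fun k _ => by simp
  rw [h]
  exact sum_mem fun k _ => mul_mem (hA (Subtype.property _)) (hy _)

theorem coadRep_lie_mem (hy : ∀ W, (fun g => coadRep G g ν ⁅y g, W⁆) ∈ A)
    (hz : ∀ W, (fun g => coadRep G g ν ⁅z g, W⁆) ∈ A) :
    (fun g => coadRep G g ν ⁅y g, z g⁆) ∈ A := by
  obtain ⟨k, e, b, h⟩ := exists_sum_mul_eq (bracketForm ν)
  rw [coadRep_lie_eq_sum ν y z h]
  exact sum_mem fun i _ => mul_mem (twist_mem hA hy _) (A.smul_mem (twist_mem hA hz _) _)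

omit hA

variable (hy : ∀ W, (fun g => coadRep G g ν ⁅y g, W⁆) ∈ germAlg G)
  (hz : ∀ W, (fun g => coadRep G g ν ⁅z g, W⁆) ∈ germAlg G)
include hy

/-- The product rule, with the fixed vector `Z` expanded in the moving frame `Ad g (e k)`, whose
coefficients are the coordinates of `Ad g⁻¹ Z`. The minus sign is due to the bracket of right
invariant fields: for it the derivative of `Ad g⁻¹ Z` at `1` along `X` is `⁅X, Z⁆`, and that of `Ad
g Z` is `-⁅X, Z⁆`. -/
theorem diffOne_twist (X Z : LieAlg G) :
    diffOne (twist ν y Z) X =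
      diffOne (fun g => coadRep G g ν ⁅y g, Z⁆) X - ν ⁅y 1, ⁅X, Z⁆⁆ := by
  have ht := twist_mem coord_le_germAlg hy
  let e := Module.finBasis ℂ (LieAlg G)
  have h : (fun g => coadRep G g ν ⁅y g, Z⁆) =
      ∑ k, (coadFun (e.coord k) Z : G → ℂ) * twist ν y (e k) := by
    funext g
    have h1 := adMap_inv_eq_sum g Z
    rw [coadRep_lie, h1, lie_sum, map_sum, Finset.sum_apply]
    refine Finset.sum_congr rfl fun k _ => ?_
    rw [lie_smul, map_smul, smul_eq_mul, Pi.mul_apply, twist_eq]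
  rw [h, diffOne_sum _ fun k => mul_mem (coord_le_germAlg (Subtype.property _)) (ht _)]
  have h2 : ∀ k, diffOne ((coadFun (e.coord k) Z : G → ℂ) * twist ν y (e k)) X =
      e.coord k Z * diffOne (twist ν y (e k)) X + e.coord k ⁅X, Z⁆ * ν ⁅y 1, e k⁆ := by
    intro k
    rw [diffOne_mul (coord_le_germAlg (Subtype.property _)) (ht _), diffOne_coe,
      tangentAt_coadFun, twist_one, coadFun_apply, map_one, mul_comm (ν _)]
    rfl
  have h3 : ∑ k, e.coord k ⁅X, Z⁆ * ν ⁅y 1, e k⁆ = ν ⁅y 1, ⁅X, Z⁆⁆ := by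
    conv_rhs => rw [← e.sum_repr ⁅X, Z⁆, lie_sum, map_sum]
    exact Finset.sum_congr rfl fun k _ => by simp
  have h4 : ∑ k, e.coord k Z * diffOne (twist ν y (e k)) X = diffOne (twist ν y Z) X := by
    conv_rhs => rw [← e.sum_repr Z, twist_sum,
      diffOne_sum _ fun k => (germAlg G).smul_mem (ht _) _]
    exact Finset.sum_congr rfl fun k _ => by rw [diffOne_smul (ht _)]; rfl
  rw [Finset.sum_congr rfl fun k _ => h2 k, Finset.sum_add_distrib, h3, h4, add_sub_cancel_right]

include hz

/-- The derivative of `ω (y, z)` for the Kostant-Kirillov form `ω`. -/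
theorem diffOne_coadRep_lie (X : LieAlg G) :
    diffOne (fun g => coadRep G g ν ⁅y g, z g⁆) X =
      diffOne (fun g => coadRep G g ν ⁅y g, z 1⁆) X - ν ⁅y 1, ⁅X, z 1⁆⁆
      - (diffOne (fun g => coadRep G g ν ⁅z g, y 1⁆) X - ν ⁅z 1, ⁅X, y 1⁆⁆) := by
  have hty := twist_mem coord_le_germAlg hy
  have htz := twist_mem coord_le_germAlg hz
  obtain ⟨k, e, b, h⟩ := exists_sum_mul_eq (bracketForm ν)
  rw [← diffOne_twist hy, ← diffOne_twist hz, coadRep_lie_eq_sum ν y z h,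
    diffOne_sum _ fun i => mul_mem (hty _) ((germAlg G).smul_mem (htz _) _)]
  -- In each term of the product rule one factor is frozen at `1`. Read backwards, the factorization
  -- collapses the two halves of the sum to one `twist` each, with the vectors `z 1` and `y 1`.
  have h1 : twist ν y (z 1) = ∑ i, ν ⁅b i, z 1⁆ • twist ν y (e i) := by
    funext g
    rw [Finset.sum_apply, twist_eq]
    refine (h _ _).trans (Finset.sum_congr rfl fun i _ => ?_)
    rw [Pi.smul_apply, twist_eq, smul_eq_mul, mul_comm]
    rfl
  have h2 : twist ν z (y 1) = ∑ i, ν ⁅y 1, e i⁆ • twist ν z (b i) := by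
    funext g
    have h3 := h (y 1) (adMap g⁻¹ (z g))
    change ν ⁅y 1, adMap g⁻¹ (z g)⁆ = ∑ i, ν ⁅y 1, e i⁆ * ν ⁅b i, adMap g⁻¹ (z g)⁆ at h3
    rw [Finset.sum_apply, twist_eq, ← lie_skew, map_neg, h3, ← Finset.sum_neg_distrib]
    refine Finset.sum_congr rfl fun i _ => ?_
    rw [Pi.smul_apply, twist_eq, ← lie_skew (adMap g⁻¹ (z g)) (b i), map_neg, smul_eq_mul, mul_neg]
  rw [h1, h2, diffOne_sum _ fun i => (germAlg G).smul_mem (hty _) _,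
    diffOne_sum _ fun i => (germAlg G).smul_mem (htz _) _, ← Finset.sum_sub_distrib]
  refine Finset.sum_congr rfl fun i _ => ?_
  rw [diffOne_mul (hty _) ((germAlg G).smul_mem (htz _) _), diffOne_smul (htz _),
    diffOne_smul (htz _), diffOne_smul (hty _), Pi.smul_apply, twist_one, twist_one,
    ← lie_skew (b i), map_neg, smul_eq_mul]
  ring

end Pairing

end AffineAlgGroup

/-! ### The weak symplectic form -/

theorem isPolyMap_of_linear {V W : Type u} [AddCommGroup V] [Module ℂ V] [AddCommGroup W]
    [Module ℂ W] (F : V →ₗ[ℂ] W) : IsPolyMap F := by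
  intro f hf
  induction hf using Algebra.adjoin_induction with
  | mem x hx =>
    obtain ⟨φ, rfl⟩ := hx
    exact Algebra.subset_adjoin ⟨φ ∘ₗ F, rfl⟩
  | algebraMap r => exact Subalgebra.algebraMap_mem _ r
  | add x y _ _ hx hy => exact add_mem hx hy
  | mul x y _ _ hx hy => exact mul_mem hx hy

namespace AlgGroupSystem

variable (S : AlgGroupSystem.{u})

theorem dι_mem_lieStabN {n m : ℕ} (h : n ≤ m) {μ : S.Dual} {X : LieAlg (S.G n)}
    (hX : X ∈ S.lieStabN n μ) : S.dι n m h X ∈ S.lieStabN m μ := by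
  intro f hf
  refine (tangentAt_lieMap _ (S.regular h) X f).trans (hX _ fun g hg => hf _ ?_)
  change S.coadRep (S.toLim m (S.ι n m h g)) μ = μ
  rw [S.toLim_ι]
  exact hg

/-- One inclusion makes the form descend to `𝔤 / 𝔤^μ`, the other makes it weakly nondegenerate
there. For the first, `X` and `Y` are moved to a common level, where the isotropy of `μ` is
contained in that of its restriction. -/
theorem lieStab_eq_ker (μ : S.Dual) : S.lieStab μ = LinearMap.ker (bracketForm μ) := by
  refine le_antisymm (iSup_le fun n => Submodule.map_le_iff_le_comap.2 fun X hX => ?_)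
    fun X hX => ?_
  · rw [Submodule.mem_comap, LinearMap.mem_ker]
    refine LinearMap.ext fun Y => ?_
    obtain ⟨m, Y, rfl⟩ := S.exists_toLie Y
    rw [← S.toLie_dι (le_max_left n m), ← S.toLie_dι (le_max_right n m) Y]
    have h := lieOf_stab_le_ker _ (lieOf_mono (S.stabN_subset _ μ)
      (S.dι_mem_lieStabN (le_max_left n m) hX))
    have h1 := LinearMap.congr_fun (LinearMap.mem_ker.1 h) (S.dι m _ (le_max_right n m) Y)
    change μ ⁅_, _⁆ = 0
    rw [toLie_lie]
    exact h1
  · obtain ⟨n, X, rfl⟩ := S.exists_toLie X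
    refine Submodule.mem_iSup_of_mem n ⟨X, S.mem_lieStabN_of_bracket fun Y => ?_, rfl⟩
    exact LinearMap.congr_fun (LinearMap.mem_ker.1 hX) Y

/-- The form `(X + 𝔤^μ, Y + 𝔤^μ) ↦ μ [X, Y]` on `G · lam`. -/
def kkLim (lam : S.Dual) : S.BilinFieldLim lam := fun μ =>
  (bracketForm_isAlt (μ : S.Dual)).isRefl.liftQ₂ (bracketForm (μ : S.Dual)) (S.lieStab μ)
    (S.lieStab_eq_ker μ).le

variable {S} {lam : S.Dual}

theorem kkLim_mk (μ : S.orbit lam) (X Y : S.Lie) :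
    S.kkLim lam μ (Submodule.Quotient.mk X) (Submodule.Quotient.mk Y) = (μ : S.Dual) ⁅X, Y⁆ := rfl

theorem kkLim_isAlt (μ : S.orbit lam) : (S.kkLim lam μ).IsAlt := by
  intro v
  obtain ⟨X, rfl⟩ := Submodule.Quotient.mk_surjective _ v
  rw [kkLim_mk, lie_self, map_zero]

theorem kkLim_injective (μ : S.orbit lam) : Function.Injective (S.kkLim lam μ) := by
  rw [← LinearMap.ker_eq_bot, eq_bot_iff]
  intro v hv
  obtain ⟨X, rfl⟩ := Submodule.Quotient.mk_surjective _ v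
  rw [Submodule.mem_bot, Submodule.Quotient.mk_eq_zero, lieStab_eq_ker, LinearMap.mem_ker]
  exact LinearMap.ext fun Y =>
    LinearMap.congr_fun (LinearMap.mem_ker.1 hv) (Submodule.Quotient.mk Y)

theorem restrictN_kkLim_mk (n : ℕ) (x : S.orbitN n lam) (X Y : LieAlg (S.G n)) :
    S.restrictN (S.kkLim lam) n x (Submodule.Quotient.mk X) (Submodule.Quotient.mk Y) =
      S.proj n x ⁅X, Y⁆ := by
  change (x : S.Dual) ⁅S.toLie n X, S.toLie n Y⁆ = _
  rw [toLie_lie]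
  rfl

theorem restrictN_kkLim (n : ℕ) : S.restrictN (S.kkLim lam) n = S.pullbackKK n lam := by
  funext x
  refine LinearMap.ext fun v => LinearMap.ext fun w => ?_
  obtain ⟨X, rfl⟩ := Submodule.Quotient.mk_surjective _ v
  obtain ⟨Y, rfl⟩ := Submodule.Quotient.mk_surjective _ w
  exact restrictN_kkLim_mk n x X Y

theorem exists_mem_orbitN {μ : S.Dual} (h : μ ∈ S.orbit lam) : ∃ n, μ ∈ S.orbitN n lam := by
  obtain ⟨g, rfl⟩ := h
  obtain ⟨n, g, rfl⟩ := S.exists_toLim g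
  exact ⟨n, g, rfl⟩

theorem orbitN_mono {n m : ℕ} (h : n ≤ m) : S.orbitN n lam ⊆ S.orbitN m lam := by
  rintro _ ⟨g, rfl⟩
  refine ⟨S.ι n m h g, ?_⟩
  dsimp only
  rw [S.toLim_ι]

/-- A family of bilinear forms on `G · lam` is determined by its restrictions to the `G_n · lam`. -/
theorem eq_of_restrictN_eq {ω ω' : S.BilinFieldLim lam}
    (h : ∀ n, S.restrictN ω n = S.restrictN ω' n) : ω = ω' := by
  funext μ
  refine LinearMap.ext fun v => LinearMap.ext fun w => ?_
  obtain ⟨X, rfl⟩ := Submodule.Quotient.mk_surjective _ v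
  obtain ⟨Y, rfl⟩ := Submodule.Quotient.mk_surjective _ w
  obtain ⟨n, X, Y, rfl, rfl⟩ := S.exists_toLie₂ X Y
  obtain ⟨m, hm⟩ := exists_mem_orbitN μ.2
  rw [← S.toLie_dι (le_max_left n m) X, ← S.toLie_dι (le_max_left n m) Y]
  exact LinearMap.congr_fun (LinearMap.congr_fun
    (congrFun (h (max n m)) ⟨μ, orbitN_mono (le_max_right n m) hm⟩)
    (Submodule.Quotient.mk _)) (Submodule.Quotient.mk _)

theorem isRegularIndPro_kkLim (μ : S.orbit lam) : S.IsRegularIndPro μ (S.kkLim lam μ) := fun m k =>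
  isPolyMap_of_linear ((S.inclT k μ).dualMap ∘ₗ S.kkLim lam μ ∘ₗ S.inclT m μ)

/-! ### Vector fields, linear functions and the form on a single `G_n · lam`. -/

section Level

variable {n : ℕ}

theorem proj_orbitMap (x : S.orbitN n lam) (g : S.G n) :
    S.proj n (S.orbitMap n lam x g) = AffineAlgGroup.coadRep (S.G n) g (S.proj n x) :=
  S.proj_coadRep n g x

theorem proj_quotMap (g : S.G n) :
    S.proj n (S.quotMap n lam g) = AffineAlgGroup.coadRep (S.G n) g (S.proj n lam) :=
  S.proj_coadRep n g lam

theorem orbitMap_one (x : S.orbitN n lam) : S.orbitMap n lam x 1 = x :=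
  Subtype.ext (by
    change S.coadRep (S.toLim n 1) (x : S.Dual) = x
    rw [toLim_one, map_one]
    rfl)

theorem exists_quotMap (x : S.orbitN n lam) : ∃ g, S.quotMap n lam g = x := by
  obtain ⟨_, g, rfl⟩ := x
  exact ⟨g, rfl⟩

theorem orbitMap_quotMap (g h : S.G n) :
    S.orbitMap n lam (S.quotMap n lam g) h = S.quotMap n lam (h * g) :=
  Subtype.ext (by
    change S.coadRep (S.toLim n h) (S.coadRep (S.toLim n g) lam) =
      S.coadRep (S.toLim n (h * g)) lam
    rw [toLim_mul, map_mul]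
    rfl)

variable (lam) in
/-- The linear function on `G_n · lam` defined by an element of `𝔤_n`. -/
def linFun (Y : LieAlg (S.G n)) (x : S.orbitN n lam) : ℂ := S.proj n x Y

theorem isRegularFun_linFun (U : Set (S.orbitN n lam)) (Y : LieAlg (S.G n)) :
    S.IsRegularFun n lam U (linFun lam Y) := by
  have h : linFun lam Y ∘ S.quotMap n lam = (coadFun (S.proj n lam) Y : S.G n → ℂ) := by
    funext g
    rw [coadFun_apply, Function.comp_apply, linFun, proj_quotMap]
  rw [IsRegularFun, h]
  exact coord_le_regularOn _ (Subtype.property _)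

theorem diff_mk (f : S.orbitN n lam → ℂ) (x : S.orbitN n lam) (X : LieAlg (S.G n)) :
    S.diff n lam f x (Submodule.Quotient.mk X) = diffOne (f ∘ S.orbitMap n lam x) X := rfl

/-- The differentials of linear functions are the contractions of the form with elements of `𝔤_n`.
This is what links the form to vector fields given only as derivations. -/
theorem diff_linFun (x : S.orbitN n lam) (X Y : LieAlg (S.G n)) :
    S.diff n lam (linFun lam Y) x (Submodule.Quotient.mk X) = S.proj n x ⁅X, Y⁆ := by
  have h : linFun lam Y ∘ S.orbitMap n lam x = (coadFun (S.proj n x) Y : S.G n → ℂ) := by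
    funext g
    rw [coadFun_apply]
    exact LinearMap.congr_fun (proj_orbitMap _ g) Y
  rw [diff_mk, h, diffOne_coe, tangentAt_coadFun]

/-- A lift of a family of tangent vectors to elements of `𝔤_n`. -/
def lift (ξ : S.TangentField n lam) (x : S.orbitN n lam) : LieAlg (S.G n) :=
  (Submodule.Quotient.mk_surjective _ (ξ x)).choose

theorem mk_lift (ξ : S.TangentField n lam) (x : S.orbitN n lam) :
    (Submodule.Quotient.mk (lift ξ x) : S.TN n x) = ξ x :=
  (Submodule.Quotient.mk_surjective _ (ξ x)).choose_spec

theorem deriv_eq (ξ : S.TangentField n lam) (f : S.orbitN n lam → ℂ) (x : S.orbitN n lam) :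
    S.deriv n lam ξ f x = diffOne (f ∘ S.orbitMap n lam x) (lift ξ x) := by
  rw [← diff_mk, mk_lift]
  rfl

theorem deriv_linFun (ξ : S.TangentField n lam) (Y : LieAlg (S.G n)) (x : S.orbitN n lam) :
    S.deriv n lam ξ (linFun lam Y) x = S.proj n x ⁅lift ξ x, Y⁆ := by
  rw [← diff_linFun, mk_lift]
  rfl

theorem deriv_deriv_linFun (ξ η : S.TangentField n lam) (x : S.orbitN n lam) (Z : LieAlg (S.G n)) :
    S.deriv n lam ξ (S.deriv n lam η (linFun lam Z)) x =
      diffOne (fun g => AffineAlgGroup.coadRep (S.G n) g (S.proj n x)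
        ⁅lift η (S.orbitMap n lam x g), Z⁆) (lift ξ x) := by
  rw [deriv_eq]
  congr 2
  funext g
  rw [Function.comp_apply, deriv_linFun, proj_orbitMap]

theorem restrictN_kkLim_apply (x : S.orbitN n lam) (ξ η : S.TangentField n lam) :
    S.restrictN (S.kkLim lam) n x (ξ x) (η x) = S.proj n x ⁅lift ξ x, lift η x⁆ := by
  rw [← restrictN_kkLim_mk, mk_lift, mk_lift]

variable {U : Set (S.orbitN n lam)} (hU : S.IsOpenSet n lam U) {ξ η ζ : S.TangentField n lam}
include hU

/-- `lift ξ` is an arbitrary choice at each point, but its pairing with a fixed `W` is the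
derivative of a linear function along `ξ`. -/
theorem coadRep_lift_mem_regularOn (hξ : S.IsVectorField n lam U ξ) (W : LieAlg (S.G n)) :
    (fun g => AffineAlgGroup.coadRep (S.G n) g (S.proj n lam) ⁅lift ξ (S.quotMap n lam g), W⁆) ∈
      regularOn (S.quotMap n lam ⁻¹' U) := by
  have h := hξ U le_rfl hU _ (isRegularFun_linFun U W)
  rw [IsRegularFun, ← mem_regularOn] at h
  convert h using 1
  funext g
  rw [Function.comp_apply, deriv_linFun, proj_quotMap]

theorem coadRep_lift_mem_germAlg (hξ : S.IsVectorField n lam U ξ) {x : S.orbitN n lam} (hx : x ∈ U)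
    (W : LieAlg (S.G n)) :
    (fun g => AffineAlgGroup.coadRep (S.G n) g (S.proj n x) ⁅lift ξ (S.orbitMap n lam x g), W⁆) ∈
      germAlg (S.G n) := by
  have h := hξ U le_rfl hU _ (isRegularFun_linFun U W)
  obtain ⟨g, rfl⟩ := exists_quotMap x
  have h1 := IsRegularOn.mem_germAlg hU h (g := g) hx
  convert h1 using 1
  funext k
  rw [Function.comp_apply, deriv_linFun, ← orbitMap_quotMap, proj_orbitMap]

/-- The arguments `lift ζ x` and `lift η x` of the linear functions are frozen at `x`, so the second
derivatives are of the kind to which the definition of the Lie bracket applies. -/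
theorem deriv_restrictN_kkLim (hη : S.IsVectorField n lam U η) (hζ : S.IsVectorField n lam U ζ)
    {x : S.orbitN n lam} (hx : x ∈ U) :
    S.deriv n lam ξ (fun y => S.restrictN (S.kkLim lam) n y (η y) (ζ y)) x =
      S.deriv n lam ξ (S.deriv n lam η (linFun lam (lift ζ x))) x
      - S.proj n x ⁅lift η x, ⁅lift ξ x, lift ζ x⁆⁆
      - (S.deriv n lam ξ (S.deriv n lam ζ (linFun lam (lift η x))) x
        - S.proj n x ⁅lift ζ x, ⁅lift ξ x, lift η x⁆⁆) := by
  have h := diffOne_coadRep_lie (coadRep_lift_mem_germAlg hU hη hx)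
    (coadRep_lift_mem_germAlg hU hζ hx) (lift ξ x)
  simp only [orbitMap_one] at h
  rw [deriv_deriv_linFun, deriv_deriv_linFun, ← h, deriv_eq]
  congr 2
  funext g
  rw [Function.comp_apply, restrictN_kkLim_apply, proj_orbitMap]

end Level

/-! ### Regularity and closedness on each `G_n · lam`. -/

theorem isTwoForm_restrictN_kkLim (n : ℕ) : S.IsTwoForm n lam (S.restrictN (S.kkLim lam) n) := by
  refine ⟨fun x v => kkLim_isAlt _ _, fun U hU ξ η hξ hη => ?_⟩
  have h := coadRep_lie_mem (coord_le_regularOn _) (coadRep_lift_mem_regularOn hU hξ)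
    (coadRep_lift_mem_regularOn hU hη)
  rw [IsRegularFun, ← mem_regularOn]
  convert h using 1
  funext g
  rw [Function.comp_apply, restrictN_kkLim_apply, proj_quotMap]

theorem isClosedForm_restrictN_kkLim (n : ℕ) :
    S.IsClosedForm n lam (S.restrictN (S.kkLim lam) n) := by
  intro U hU ξ η ζ ξη ξζ ηζ hξ hη hζ _ _ _ bξη bξζ bηζ x hx
  -- Each bracket field is tested on the linear function of the third field's value at `x`; this
  -- turns `ω ([ξ, η], ζ)` and its analogues into second derivatives.
  have h1 := bξη U le_rfl hU _ (isRegularFun_linFun U (lift ζ x)) x hx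
  have h2 := bξζ U le_rfl hU _ (isRegularFun_linFun U (lift η x)) x hx
  have h3 := bηζ U le_rfl hU _ (isRegularFun_linFun U (lift ξ x)) x hx
  rw [deriv_linFun] at h1 h2 h3
  rw [deriv_restrictN_kkLim hU hη hζ hx, deriv_restrictN_kkLim hU hξ hζ hx,
    deriv_restrictN_kkLim hU hξ hη hx, restrictN_kkLim_apply, restrictN_kkLim_apply,
    restrictN_kkLim_apply, h1, h2, h3]
  generalize lift ξ x = X
  generalize lift η x = Y
  generalize lift ζ x = Z
  have j := congrArg (S.proj n x) (lie_jacobi X Y Z)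
  have s1 : S.proj n x ⁅Y, ⁅X, Z⁆⁆ = - S.proj n x ⁅Y, ⁅Z, X⁆⁆ := by
    rw [← lie_skew X Z, lie_neg, map_neg]
  have s2 : S.proj n x ⁅Z, ⁅Y, X⁆⁆ = - S.proj n x ⁅Z, ⁅X, Y⁆⁆ := by
    rw [← lie_skew Y X, lie_neg, map_neg]
  have s3 : S.proj n x ⁅X, ⁅Z, Y⁆⁆ = - S.proj n x ⁅X, ⁅Y, Z⁆⁆ := by
    rw [← lie_skew Z Y, lie_neg, map_neg]
  rw [map_add, map_add, map_zero] at j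
  rw [s1, s2, s3]
  -- The second derivatives cancel in pairs. Each of the three derivatives of the form contributes
  -- two iterated brackets, so every cyclic term of the Jacobi identity occurs twice.
  linear_combination 2 * j

end AlgGroupSystem

theorem proposition4p1 (S : AlgGroupSystem.{u}) (lam : S.Dual) :
    ∃ ω : S.BilinFieldLim lam,
      (∀ n, S.restrictN ω n = S.pullbackKK n lam) ∧
      (∀ ω' : S.BilinFieldLim lam, (∀ n, S.restrictN ω' n = S.pullbackKK n lam) → ω' = ω) ∧
      (∀ (μ : S.orbit lam) (X Y : S.Lie),
        ω μ (Submodule.Quotient.mk X) (Submodule.Quotient.mk Y) = (μ : S.Dual) ⁅X, Y⁆) ∧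
      S.IsWeakSymplectic ω :=
  ⟨S.kkLim lam, AlgGroupSystem.restrictN_kkLim,
    fun _ h => AlgGroupSystem.eq_of_restrictN_eq fun n =>
      (h n).trans (AlgGroupSystem.restrictN_kkLim n).symm,
    AlgGroupSystem.kkLim_mk,
    { alt := AlgGroupSystem.kkLim_isAlt
      twoForm := AlgGroupSystem.isTwoForm_restrictN_kkLim
      closed := AlgGroupSystem.isClosedForm_restrictN_kkLim
      injective := AlgGroupSystem.kkLim_injective
      regular := AlgGroupSystem.isRegularIndPro_kkLim }⟩

end
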